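/- Let $\mathscr D(\mathbb R^d)$ be the space of (real- or complex-valued) test functions and $\mathscr D'(\mathbb R^d)$ its dual. Let $Y(\mathbb R^d)$ be the Fréchet space of all $f\in C^\infty(\mathbb R^d)$ with $\sup_x |f^{(\alpha)}(x)|\,e^{k|x|}<\infty$ for all multi-indices $\alpha$ and all $k\in\mathbb N$, with the topology given by these expressions as seminorms. Since $\mathscr D(\mathbb R^d)$ is dense in $Y(\mathbb R^d)$, the dual $Y(\mathbb R^d)'$ is regarded as a subspace of $\mathscr D'(\mathbb R^d)$. Let $\mathcal B$ be the Fréchet space of all $C^\infty$-functions on $\mathbb R^d$ that are bounded together with all their derivatives; a distribution is said to belong to $\mathcal B'$ if it extends to a continuous linear functional on $\mathcal B$. Put $\omega(x)=\sum_{\eta\in\{-1,+1\}^d} e^{\eta\cdot x}$. For a distribution $S$ and a test function $\varphi$ let $(S*\varphi)(y)=S_x\varphi(y-x)$. For $T\in\mathscr D'(\mathbb R^d)$ the following are equivalent: 1. $\omega(kx)T\in\mathcal B'$ for every $k\in\mathbb N$. 2. For every $k\in\mathbb N$ there are finitely many measurable functions $t_\beta$ (indexed by multi-indices $\beta$) such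 that $e^{k|x|}t_\beta\in L_\infty(\mathbb R^d)$ and $T=\sum_\beta\partial^\beta t_\beta$. 3. $T\in Y(\mathbb R^d)'$, and for every $\varphi\in Y(\mathbb R^d)$ the function $y\mapsto T_x\varphi(x+y)$ belongs to $Y(\mathbb R^d)$. 4. For every $\varphi\in\mathscr D(\mathbb R^d)$ the function $f(y)=T_x\varphi(x+y)$ is continuous and exponentially decreasing, that is, $\sup_y|f(y)|\,e^{k|y|}<\infty$ for all $k\in\mathbb N$. 5. For every $k\in\mathbb N$ and every $\varphi\in\mathscr D(\mathbb R^d)$ the function $(\omega(kx)T)*\varphi$ is continuous and bounded. -/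

import Mathlib

open MeasureTheory TopologicalSpace
open scoped Distributions ContDiff LineDeriv

noncomputable section

namespace ExpDecay

/-- The Euclidean space `ℝ^d`. -/
abbrev Rd (d : ℕ) : Type := EuclideanSpace ℝ (Fin d)

/-- Test functions on `ℝ^d`: compactly supported `C^∞` functions with values in `𝕜`
(`ℝ` or `ℂ`), with the canonical LF topology. -/
abbrev Test (d : ℕ) (𝕜 : Type*) [RCLike 𝕜] : Type _ := 𝓓((⊤ : Opens (Rd d)), 𝕜)

/-- Distributions on `ℝ^d`: continuous `𝕜`-linear functionals on the test functions. -/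
abbrev Distr (d : ℕ) (𝕜 : Type*) [RCLike 𝕜] : Type _ := Test d 𝕜 →L[𝕜] 𝕜

section Spaces

variable {d : ℕ} {𝕜 : Type*} [RCLike 𝕜]

/-! ### Operations on test functions and on distributions -/

/-- The test function `x ↦ φ (x + y)`. -/
def testTranslate (y : Rd d) (φ : Test d 𝕜) : Test d 𝕜 where
  toFun x := φ (x + y)
  contDiff' := φ.contDiff.comp (contDiff_id.add contDiff_const)
  hasCompactSupport' := φ.hasCompactSupport.comp_homeomorph (Homeomorph.addRight y)
  tsupport_subset' := fun _ _ => trivial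

/-- The test function `x ↦ φ (y - x)`. -/
def testReflect (y : Rd d) (φ : Test d 𝕜) : Test d 𝕜 where
  toFun x := φ (y - x)
  contDiff' := φ.contDiff.comp (contDiff_const.sub contDiff_id)
  hasCompactSupport' := φ.hasCompactSupport.comp_homeomorph (Homeomorph.subLeft y)
  tsupport_subset' := fun _ _ => trivial

/-- Multiplication of test functions by a smooth real function `g`, as a continuous linear map. -/
def testMul (g : Rd d → ℝ) (hg : ContDiff ℝ ∞ g) : Test d 𝕜 →L[𝕜] Test d 𝕜 :=
  have hg' : ContDiff ℝ ∞ (fun x => (g x : 𝕜)) := by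
    have h := (RCLike.ofRealCLM (K := 𝕜)).contDiff (n := ∞)
    exact h.comp hg
  TestFunction.limitCLM 𝕜
    (fun φ =>
      { toFun := fun x => φ x * (g x : 𝕜)
        contDiff' := φ.contDiff.mul hg'
        hasCompactSupport' := φ.hasCompactSupport.mul_right
        tsupport_subset' := fun _ _ => trivial })
    (fun _ K_sub => TestFunction.ofSupportedInCLM 𝕜 K_sub ∘L
      ContDiffMapSupportedIn.bilinLeftCLM (ContinuousLinearMap.mul 𝕜 𝕜) hg')
    (fun _ _ _ => rfl)

/-- The product `g T` of a smooth function and a distribution: `(g T) φ = T (g φ)`. -/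
def mulDistr (g : Rd d → ℝ) (hg : ContDiff ℝ ∞ g) (T : Distr d 𝕜) : Distr d 𝕜 :=
  T ∘L testMul g hg

/-- The convolution `(T * φ)(y) = T_x φ(y - x)` of a distribution and a test function. -/
def conv (T : Distr d 𝕜) (φ : Test d 𝕜) (y : Rd d) : 𝕜 := T (testReflect y φ)

/-- The regular distribution `φ ↦ ∫ φ t` given by a locally integrable function `t`. -/
def ofFun (t : Rd d → 𝕜) : Distr d 𝕜 :=
  TestFunction.integralAgainstBilinCLM (ContinuousLinearMap.mul 𝕜 𝕜) volume t

/-- The partial derivative `∂_j T` of a distribution: `(∂_j T) φ = -T (∂_j φ)`. -/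
def partialDeriv (j : Fin d) (T : Distr d 𝕜) : Distr d 𝕜 :=
  -(T ∘L LineDeriv.lineDerivOpCLM 𝕜 (Test d 𝕜) (EuclideanSpace.single j (1 : ℝ)))

/-- `∂^β T = ∂_1^{β_1} ⋯ ∂_d^{β_d} T` for a multi-index `β`. -/
def multiDeriv (β : Fin d → ℕ) (T : Distr d 𝕜) : Distr d 𝕜 :=
  (List.finRange d).foldr (fun j S => (partialDeriv j)^[β j] S) T

/-! ### Spaces of smooth functions defined by weighted sup-norms -/

section Weighted

variable {ι : Type}

variable (𝕜) in
/-- The smooth functions `f` such that, for each weight `w i` and each `n`, the total derivative of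
order `n` of `f` (that is, all partial derivatives of order `n`) is bounded after multiplication
by `w i`. -/
def weighted (w : ι → Rd d → ℝ) : Submodule 𝕜 (Rd d → 𝕜) where
  carrier := {f | ContDiff ℝ ∞ f ∧
    ∀ i n, BddAbove (Set.range fun x => ‖w i x • iteratedFDeriv ℝ n f x‖)}
  zero_mem' := by
    refine ⟨contDiff_const, fun i n => ⟨0, ?_⟩⟩
    rintro _ ⟨x, rfl⟩
    have h : iteratedFDeriv ℝ n (0 : Rd d → 𝕜) x = 0 :=
      congrFun (iteratedFDeriv_fun_zero (𝕜 := ℝ) (E := Rd d) (F := 𝕜) (n := n)) x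
    simp [h]
  add_mem' := by
    rintro f g ⟨hf, hf'⟩ ⟨hg, hg'⟩
    refine ⟨hf.add hg, fun i n => ?_⟩
    obtain ⟨A, hA⟩ := hf' i n
    obtain ⟨B, hB⟩ := hg' i n
    refine ⟨A + B, ?_⟩
    rintro _ ⟨x, rfl⟩
    have h := iteratedFDeriv_add_apply (𝕜 := ℝ) (i := n) (x := x)
      (hf.of_le (mod_cast le_top)).contDiffAt (hg.of_le (mod_cast le_top)).contDiffAt
    simp only [h, smul_add]
    exact (norm_add_le _ _).trans (add_le_add (hA ⟨x, rfl⟩) (hB ⟨x, rfl⟩))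
  smul_mem' := by
    rintro c f ⟨hf, hf'⟩
    refine ⟨hf.const_smul c, fun i n => ?_⟩
    obtain ⟨A, hA⟩ := hf' i n
    refine ⟨‖c‖ * A, ?_⟩
    rintro _ ⟨x, rfl⟩
    have h := iteratedFDeriv_const_smul_apply (𝕜 := ℝ) (i := n) (x := x) (a := c)
      (hf.of_le (mod_cast le_top)).contDiffAt
    simp only [h, smul_comm _ c, norm_smul c]
    exact mul_le_mul_of_nonneg_left (hA ⟨x, rfl⟩) (norm_nonneg c)

variable (𝕜) in
/-- `weighted 𝕜 w` as a topological vector space; its topology is not that of pointwise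
convergence but is given by the seminorms `weightedSeminorm` below. -/
def Weighted (w : ι → Rd d → ℝ) : Type _ := ↥(weighted 𝕜 w)

instance (w : ι → Rd d → ℝ) : AddCommGroup (Weighted 𝕜 w) :=
  inferInstanceAs (AddCommGroup ↥(weighted 𝕜 w))

instance (w : ι → Rd d → ℝ) : Module 𝕜 (Weighted 𝕜 w) :=
  inferInstanceAs (Module 𝕜 ↥(weighted 𝕜 w))

instance (w : ι → Rd d → ℝ) : CoeFun (Weighted 𝕜 w) (fun _ => Rd d → 𝕜) :=
  ⟨fun f => f.1⟩

/-- The seminorm `f ↦ sup_x ‖w i x • D^n f x‖`. -/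
def weightedSeminorm (w : ι → Rd d → ℝ) (p : ι × ℕ) : Seminorm 𝕜 (Weighted 𝕜 w) :=
  Seminorm.of (fun f => ⨆ x, ‖w p.1 x • iteratedFDeriv ℝ p.2 f x‖)
    (by
      intro f g
      refine ciSup_le fun x => ?_
      have h := iteratedFDeriv_add_apply (𝕜 := ℝ) (i := p.2) (x := x)
        (f.2.1.of_le (mod_cast le_top)).contDiffAt (g.2.1.of_le (mod_cast le_top)).contDiffAt
      change ‖w p.1 x • iteratedFDeriv ℝ p.2 (f.1 + g.1) x‖ ≤ _
      rw [h, smul_add]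
      exact (norm_add_le _ _).trans
        (add_le_add (le_ciSup (f.2.2 p.1 p.2) x) (le_ciSup (g.2.2 p.1 p.2) x)))
    (by
      intro c f
      rw [Real.mul_iSup_of_nonneg (norm_nonneg c)]
      refine iSup_congr fun x => ?_
      have h := iteratedFDeriv_const_smul_apply (𝕜 := ℝ) (i := p.2) (x := x) (a := c)
        (f.2.1.of_le (mod_cast le_top)).contDiffAt
      change ‖w p.1 x • iteratedFDeriv ℝ p.2 (c • f.1) x‖ = _
      rw [h, smul_comm, norm_smul c])

/-- The locally convex topology defined by all the seminorms `weightedSeminorm w p`. -/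
instance (w : ι → Rd d → ℝ) : TopologicalSpace (Weighted 𝕜 w) :=
  (SeminormFamily.moduleFilterBasis (weightedSeminorm (𝕜 := 𝕜) w)).topology

theorem weighted_withSeminorms (w : ι → Rd d → ℝ) :
    WithSeminorms (weightedSeminorm (𝕜 := 𝕜) w) := ⟨rfl⟩

theorem test_mem_weighted {w : ι → Rd d → ℝ} (hw : ∀ i, Continuous (w i)) (φ : Test d 𝕜) :
    (φ : Rd d → 𝕜) ∈ weighted 𝕜 w := by
  refine ⟨φ.contDiff, fun i n => ?_⟩
  have hc : Continuous fun x => w i x • iteratedFDeriv ℝ n φ x :=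
    (hw i).smul (φ.contDiff.continuous_iteratedFDeriv (mod_cast le_top))
  have hs : HasCompactSupport fun x => w i x • iteratedFDeriv ℝ n φ x := by
    refine (φ.hasCompactSupport.iteratedFDeriv (𝕜 := ℝ) n).mono fun x hx h => hx ?_
    change w i x • iteratedFDeriv ℝ n φ x = 0
    rw [h, smul_zero]
  obtain ⟨C, hC⟩ := hc.bounded_above_of_compact_support hs
  exact ⟨C, by rintro _ ⟨x, rfl⟩; exact hC x⟩

/-- The inclusion of the test functions. -/
def ofTest {w : ι → Rd d → ℝ} (hw : ∀ i, Continuous (w i)) (φ : Test d 𝕜) : Weighted 𝕜 w :=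
  ⟨φ, test_mem_weighted hw φ⟩

/-- The continuous linear functional `S` on a space of smooth functions that contains the test
functions restricts to the distribution `T`. -/
def Extends {w : ι → Rd d → ℝ} (hw : ∀ i, Continuous (w i)) (S : Weighted 𝕜 w →L[𝕜] 𝕜)
    (T : Distr d 𝕜) : Prop :=
  ∀ φ : Test d 𝕜, S (ofTest hw φ) = T φ

end Weighted

/-! ### The space `B` of bounded smooth functions with bounded derivatives, and its dual -/

/-- The trivial weight. -/
def oneWeight (d : ℕ) : Unit → Rd d → ℝ := fun _ _ => 1

theorem oneWeight_continuous (i : Unit) : Continuous (oneWeight d i) := continuous_const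

variable (d 𝕜) in
/-- The space of smooth functions all of whose derivatives are bounded. -/
abbrev BSpace : Type _ := Weighted 𝕜 (oneWeight d)

/-- `T ∈ B'`: the distribution `T` is given by a continuous linear functional on `B`. -/
def InBDual (T : Distr d 𝕜) : Prop :=
  ∃ S : BSpace d 𝕜 →L[𝕜] 𝕜, Extends oneWeight_continuous S T

/-! ### The space `Y` of exponentially decreasing smooth functions -/

/-- The weights `e^{k|x|}`, `k ∈ ℕ`. -/
def expWeight (d : ℕ) : ℕ → Rd d → ℝ := fun k x => Real.exp (k * ‖x‖)

theorem expWeight_continuous (k : ℕ) : Continuous (expWeight d k) := by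
  unfold expWeight; fun_prop

variable (d 𝕜) in
/-- The space `Y(ℝ^d)` of smooth functions `f` with `sup_x |f^{(α)}(x)| e^{k|x|} < ∞` for all `α`
and `k`, with its Fréchet topology. -/
abbrev YSpace : Type _ := Weighted 𝕜 (expWeight d)

theorem translate_mem_Y (y : Rd d) {f : Rd d → 𝕜} (hf : f ∈ weighted 𝕜 (expWeight d)) :
    (fun x => f (x + y)) ∈ weighted 𝕜 (expWeight d) := by
  refine ⟨hf.1.comp (contDiff_id.add contDiff_const), fun k n => ?_⟩
  obtain ⟨C, hC⟩ := hf.2 k n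
  refine ⟨Real.exp (k * ‖y‖) * C, ?_⟩
  rintro _ ⟨x, rfl⟩
  have h := hC ⟨x + y, rfl⟩
  simp only [norm_smul, expWeight, Real.norm_eq_abs, Real.abs_exp] at h ⊢
  rw [iteratedFDeriv_comp_add_right]
  calc Real.exp (k * ‖x‖) * ‖iteratedFDeriv ℝ n f (x + y)‖
      ≤ (Real.exp (k * ‖y‖) * Real.exp (k * ‖x + y‖)) * ‖iteratedFDeriv ℝ n f (x + y)‖ := by
        gcongr
        rw [← Real.exp_add, ← mul_add]
        gcongr
        have := norm_sub_le (x + y) y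
        simp only [add_sub_cancel_right] at this
        linarith
    _ = Real.exp (k * ‖y‖) * (Real.exp (k * ‖x + y‖) * ‖iteratedFDeriv ℝ n f (x + y)‖) := by ring
    _ ≤ _ := by gcongr

/-- The function `x ↦ φ (x + y)` in `Y`, for `φ ∈ Y`. -/
def yTranslate (y : Rd d) (φ : YSpace d 𝕜) : YSpace d 𝕜 :=
  ⟨fun x => φ (x + y), translate_mem_Y y φ.2⟩

/-! ### The weight function `ω` -/

/-- `ω(x) = ∑_{η ∈ {-1,1}^d} e^{η·x}`. -/
def omega (x : Rd d) : ℝ :=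
  ∑ η ∈ Fintype.piFinset fun _ : Fin d => ({-1, 1} : Finset ℝ), Real.exp (∑ j, η j * x j)

theorem omega_smul_contDiff (k : ℕ) : ContDiff ℝ ∞ fun x : Rd d => omega ((k : ℝ) • x) := by
  unfold omega
  simp only [PiLp.smul_apply]
  fun_prop

/-- The distribution `ω(kx) T`. -/
def omegaMul (k : ℕ) (T : Distr d 𝕜) : Distr d 𝕜 :=
  mulDistr (fun x => omega ((k : ℝ) • x)) (omega_smul_contDiff k) T

/-- `f` is an exponentially decreasing continuous function. -/
def ExpDecreasing (f : Rd d → 𝕜) : Prop :=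
  Continuous f ∧ ∀ k : ℕ, ∃ C : ℝ, ∀ y, ‖f y‖ * Real.exp (k * ‖y‖) ≤ C

end Spaces

end ExpDecay

end

open ExpDecay

/-!
The five conditions all say that `T` is exponentially decreasing, and each is compared with one of
three intermediate properties of `T`.

* `LocalDecay T`: for each `k` and each compact set `K` there are `C` and `N` such that
  `|T_x φ(x + y)|` is at most `C e^{-k|y|}` times the `C^N`-norm of `φ`, for all test functions `φ`
  supported in `K`. The order `N` does not depend on `y`.
* `IntegralBound T`: for each `k` there is an order `N` such that `|T φ|` is at most a constant
  times the sum over `n ≤ N` of the integrals of `|D^n φ(x)| e^{-k|x|}`.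
* `Represented T`: for each `k`, the functional `T` is a finite sum of integrals of iterated partial
  derivatives of `φ` against measurable densities of size `O(e^{-k|x|})`.

Conditions 4 and 5 are pointwise in the test function. A space of test functions with support in
a fixed compact set is a closed subspace of a countable product of Banach spaces, so it is
barrelled, and the Banach-Steinhaus theorem turns these conditions into local decay
(`localDecay_of_translates`, `localDecay_of_conv_omegaMul`). For condition 5 the weight `ω(kx)` is
comparable to `e^{k|x|}` up to the value of `k`, and division by it costs only derivatives of
`1 / ω(kx)`, all of which are bounded by multiples of `e^{-k|x|}`.

A smooth partition of unity made of lattice translates splits `φ` into pieces supported in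
translates of one ball. Since the sup-norm of a compactly supported function is at most the integral of its
derivative of order `d`, the local estimates add up to a weighted `L¹` estimate
(`LocalDecay.integralBound`). This estimate says that `T` factors through the jet of `φ` as a
bounded functional on a subspace of an `L¹` space of a finite measure; a Hahn-Banach extension of
it is given by bounded densities (`IntegralBound.represented`). Equality of mixed partial
derivatives regroups them by multi-index, which is condition 2.

Conversely, densities of size `O(e^{-k|x|})` define functionals on the space of bounded smooth
functions, also after multiplication of `T` by `ω(kx)`, and on `Y`, which give conditions 1 and 3.
For condition 3 the functionals on `Y` obtained for different `k` are the same, because truncation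
shows that test functions are dense in `Y`, and a correlation of a density with a rapidly decaying
function is smooth and decays like the density, by differentiation under the integral sign.
Restricting the functionals to translates of test functions gives back conditions 4 and 5.
-/

noncomputable section

namespace ExpDecay

/-! ### Uniform boundedness on test functions with support in a fixed compact set -/

section UniformBoundedness

open Filter Topology

variable {E F : Type*} [NormedAddCommGroup E] [NormedSpace ℝ E] [NormedAddCommGroup F]
  [NormedSpace ℝ F]

/-- The derivatives of all orders embed `𝓓_K` as a closed subspace of a product of Banach spaces:
uniform limits of all the derivatives are the derivatives of the limit. -/
theorem isClosed_range_structureMap (K : Compacts E) :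
    IsClosed (Set.range (ContinuousLinearMap.pi
      (ContDiffMapSupportedIn.structureMapCLM (K := K) (E := E) (F := F) ℝ ⊤))) := by
  refine isClosed_of_closure_subset fun g hg => ?_
  set Φ := ContinuousLinearMap.pi
      (ContDiffMapSupportedIn.structureMapCLM (K := K) (E := E) (F := F) ℝ ⊤) with hΦ
  set l : Filter 𝓓_{K}(E, F) := comap Φ (𝓝 g) with hl'
  have : l.NeBot := comap_neBot fun t ht => by
    obtain ⟨_, hy, a, rfl⟩ := mem_closure_iff_nhds.mp hg t ht
    exact ⟨a, hy⟩
  have ht : Tendsto Φ l (𝓝 g) := tendsto_comap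
  have hu : ∀ n, TendstoUniformly (fun (f : 𝓓_{K}(E, F)) x => iteratedFDeriv ℝ n f x) (g n) l := by
    intro n
    have h := BoundedContinuousFunction.tendsto_iff_tendstoUniformly.mp
      ((tendsto_pi_nhds.mp ht) n)
    have h0 : ∀ (f : 𝓓_{K}(E, F)) x, Φ f n x = iteratedFDeriv ℝ n f x := fun f x =>
      congrFun (ContDiffMapSupportedIn.structureMapCLM_top_apply ℝ f) x
    have h1 : (fun (f : 𝓓_{K}(E, F)) x => iteratedFDeriv ℝ n f x) = fun f => ⇑(Φ f n) :=
      funext fun f => funext fun x => (h0 f x).symm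
    rw [h1]
    exact h
  have hT : HasFTaylorSeriesUpTo ∞ (fun x => (g 0 x).curry0) (fun x n => g n x) := by
    refine ⟨fun x => rfl, fun m _ x => ?_, fun m _ => (g m).continuous⟩
    refine hasFDerivAt_of_tendstoUniformly (l := l)
      (f := fun (f : 𝓓_{K}(E, F)) x => iteratedFDeriv ℝ m f x)
      (f' := fun (f : 𝓓_{K}(E, F)) x => (iteratedFDeriv ℝ (m + 1) f x).curryLeft)
      (g' := fun x => (g (m + 1) x).curryLeft) ?_ ?_ ?_ x
    · exact (continuousMultilinearCurryLeftEquiv ℝ (fun _ : Fin (m + 1) => E)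
        F).isometry.uniformContinuous.comp_tendstoUniformly (hu (m + 1))
    · intro f x
      exact (f.contDiff.ftaylorSeries).fderiv m (by exact_mod_cast WithTop.coe_lt_top _) x
    · intro x
      exact (hu m).tendsto_at x
  refine ⟨⟨fun x => (g 0 x).curry0, hT.contDiff, fun x hx => ?_⟩, ?_⟩
  · have h0 : Tendsto (fun f : 𝓓_{K}(E, F) => iteratedFDeriv ℝ 0 f x) l (𝓝 (g 0 x)) :=
      (hu 0).tendsto_at x
    have h1 : Tendsto (fun f : 𝓓_{K}(E, F) => iteratedFDeriv ℝ 0 f x) l (𝓝 0) := by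
      refine tendsto_const_nhds.congr fun f => ?_
      exact (f.iteratedFDeriv_zero_on_compl hx).symm
    have := tendsto_nhds_unique h0 h1
    simp [this]
  · funext n
    ext x : 1
    have := hT.eq_iteratedFDeriv (m := n) (by exact_mod_cast le_top) x
    simp only [hΦ, ContinuousLinearMap.coe_pi']
    rw [this, ContDiffMapSupportedIn.structureMapCLM_top_apply]
    rfl

/-- `𝓓_K` is a complete space with a countably generated uniformity, hence a Baire space. -/
instance barrelledSpace_supportedIn {𝕜 : Type*} [NontriviallyNormedField 𝕜] [NormedSpace 𝕜 F]
    [SMulCommClass ℝ 𝕜 F] [CompleteSpace F] (K : Compacts E) : BarrelledSpace 𝕜 𝓓_{K}(E, F) := by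
  have he := ContDiffMapSupportedIn.isUniformEmbedding_pi_structureMapCLM (n := ⊤) (K := K)
    (E := E) (F := F) ℝ
  have : CompleteSpace 𝓓_{K}(E, F) := by
    rw [completeSpace_iff_isComplete_range he.isUniformInducing]
    exact (isClosed_range_structureMap K).isComplete
  have : (uniformity 𝓓_{K}(E, F)).IsCountablyGenerated := by
    rw [← he.isUniformInducing.comap_uniformity]
    infer_instance
  have : BaireSpace 𝓓_{K}(E, F) := inferInstance
  exact BaireSpace.instBarrelledSpace

variable {d : ℕ} {𝕜 : Type*} [RCLike 𝕜]

/-- **Uniform boundedness.** A pointwise bounded family of distributions is, on the test functions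
supported in a fixed compact set, uniformly bounded by the derivatives of some finite order. -/
theorem uniform_bound_of_pointwise_bound {ι : Type*} (L : ι → Distr d 𝕜)
    (hL : ∀ φ, ∃ C : ℝ, ∀ i, ‖L i φ‖ ≤ C) (K : Compacts (Rd d)) :
    ∃ (C : ℝ) (N : ℕ), 0 ≤ C ∧ ∀ i (φ : Test d 𝕜), Function.support φ ⊆ K → ∀ B : ℝ, 0 ≤ B →
      (∀ n ≤ N, ∀ x, ‖iteratedFDeriv ℝ n φ x‖ ≤ B) → ‖L i φ‖ ≤ C * B := by
  have hK : (K : Set (Rd d)) ⊆ (⊤ : Opens (Rd d)) := fun _ _ => trivial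
  let M : ι → 𝓓_{K}(Rd d, 𝕜) →L[𝕜] 𝕜 := fun i => L i ∘L TestFunction.ofSupportedInCLM 𝕜 hK
  have hM : UniformEquicontinuous ((↑) ∘ M : ι → 𝓓_{K}(Rd d, 𝕜) → 𝕜) := by
    refine (norm_withSeminorms 𝕜 𝕜).banach_steinhaus fun _ f => ?_
    obtain ⟨C, hC⟩ := hL (TestFunction.ofSupportedIn hK f)
    exact ⟨C, by rintro _ ⟨i, rfl⟩; exact hC i⟩
  obtain ⟨p, hp, hMp⟩ :=
    ((norm_withSeminorms 𝕜 𝕜).uniformEquicontinuous_iff_exists_continuous_seminorm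
      (fun i => (M i).toLinearMap)).mp hM 0
  obtain ⟨s, C, -, hC⟩ := Seminorm.bound_of_continuous
    (ContDiffMapSupportedIn.withSeminorms 𝕜 (Rd d) 𝕜 ⊤ K) p hp
  refine ⟨C, s.sup id, C.2, fun i φ hφ B hB h => ?_⟩
  let f : 𝓓_{K}(Rd d, 𝕜) := .of_support_subset φ.contDiff hφ
  have h1 : ‖L i φ‖ ≤ p f := hMp i f
  have h2 : p f ≤ C * (s.sup (ContDiffMapSupportedIn.seminorm 𝕜 (Rd d) 𝕜 ⊤ K)) f := hC f
  refine h1.trans (h2.trans (mul_le_mul_of_nonneg_left ?_ C.2))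
  refine Seminorm.finset_sup_apply_le hB fun n hn => ?_
  rw [ContDiffMapSupportedIn.seminorm_top_le_iff 𝕜 hB]
  exact fun x _ => h n (Finset.le_sup (f := id) hn) x

end UniformBoundedness

/-! ### The sup-norm is controlled by the integral of the derivatives of order `d` -/

section Sobolev

variable {d : ℕ} {G : Type*} [NormedAddCommGroup G] [NormedSpace ℝ G]

/-- A value of `g` is the integral of its derivative along the line in the direction of the `j`-th
coordinate. -/
theorem enorm_le_lintegral_line {g : Rd d → G} (hg : ContDiff ℝ 1 g) (hs : HasCompactSupport g)
    (j : Fin d) (x : Fin d → ℝ) :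
    ‖g (WithLp.toLp 2 x)‖ₑ ≤ ∫⁻ t, ‖fderiv ℝ g (WithLp.toLp 2 (Function.update x j t))‖ₑ := by
  let γ : ℝ → Rd d := fun t => WithLp.toLp 2 (Function.update x j t)
  have hγ : ∀ t, HasDerivAt γ (EuclideanSpace.single j (1 : ℝ)) t := by
    intro t
    have h := ((PiLp.continuousLinearEquiv 2 ℝ (fun _ : Fin d => ℝ)).symm.hasFDerivAt
      (x := Function.update x j t)).comp_hasDerivAt t (hasDerivAt_update x j t)
    exact h
  have hγc : ContDiff ℝ 1 γ :=
    (PiLp.continuousLinearEquiv 2 ℝ (fun _ : Fin d => ℝ)).symm.contDiff.comp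
      (by convert! contDiff_update 1 x j)
  have hγe : Topology.IsClosedEmbedding γ :=
    (PiLp.homeomorph 2 (fun _ : Fin d => ℝ)).symm.isClosedEmbedding.comp
      (isClosedEmbedding_update x j)
  have h := HasCompactSupport.enorm_le_lintegral_Ici_deriv (hg.comp hγc)
    (hs.comp_isClosedEmbedding hγe) (x j)
  have h0 : (g ∘ γ) (x j) = g (WithLp.toLp 2 x) := by simp [γ]
  rw [h0] at h
  refine h.trans ((lintegral_mono' Measure.restrict_le_self le_rfl).trans ?_)
  refine lintegral_mono fun t => ?_
  have hd := ((hg.differentiable one_ne_zero (γ t)).hasFDerivAt.comp_hasDerivAt t (hγ t)).deriv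
  rw [hd]
  refine (ContinuousLinearMap.le_opENorm _ _).trans ?_
  have : ‖EuclideanSpace.single j (1 : ℝ)‖ₑ = 1 := by
    rw [← ofReal_norm]; simp
  rw [this, mul_one]

/-- Each coordinate in `s` that is integrated over costs one derivative. -/
theorem enorm_iteratedFDeriv_le_lmarginal {g : Rd d → G} (hg : ContDiff ℝ ∞ g)
    (hs : HasCompactSupport g) (n : ℕ) (s : Finset (Fin d)) (x : Fin d → ℝ) :
    ‖iteratedFDeriv ℝ n g (WithLp.toLp 2 x)‖ₑ ≤ lmarginal (fun _ => volume) s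
      (fun z => ‖iteratedFDeriv ℝ (n + s.card) g (WithLp.toLp 2 z)‖ₑ) x := by
  induction s using Finset.induction_on generalizing x with
  | empty =>
    rw [lmarginal_empty]
    exact le_rfl
  | insert j s hj ih =>
    have hc : ∀ m : ℕ, Continuous (fun z : Fin d → ℝ =>
        ‖iteratedFDeriv ℝ m g (WithLp.toLp 2 z)‖ₑ) := fun m =>
      ((hg.continuous_iteratedFDeriv (mod_cast le_top)).comp
        (PiLp.continuous_toLp 2 _)).enorm
    rw [lmarginal_insert' _ (hc _).measurable hj]
    refine (ih x).trans (lmarginal_mono (fun z => ?_) x)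
    refine (enorm_le_lintegral_line (hg.iteratedFDeriv_right (m := 1) (mod_cast le_top))
      (hs.iteratedFDeriv (n + s.card)) j z).trans (le_of_eq ?_)
    rw [Finset.card_insert_of_notMem hj]
    refine lintegral_congr fun t => ?_
    rw [← ofReal_norm, ← ofReal_norm, norm_fderiv_iteratedFDeriv]
    rfl

/-- The derivatives of a smooth function with compact support on `ℝ^d` are bounded by the integrals
of its derivatives of an order higher by `d`: integrate once in each coordinate direction. -/
theorem norm_iteratedFDeriv_le_integral {g : Rd d → G} (hg : ContDiff ℝ ∞ g)
    (hs : HasCompactSupport g) (n : ℕ) (x : Rd d) :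
    ‖iteratedFDeriv ℝ n g x‖ ≤ ∫ z, ‖iteratedFDeriv ℝ (n + d) g z‖ := by
  have h := enorm_iteratedFDeriv_le_lmarginal hg hs n Finset.univ (WithLp.ofLp x)
  have hc : Continuous (fun z => ‖iteratedFDeriv ℝ (n + d) g z‖) :=
    (hg.continuous_iteratedFDeriv (mod_cast le_top)).norm
  have hi : Integrable (fun z => ‖iteratedFDeriv ℝ (n + d) g z‖) :=
    hc.integrable_of_hasCompactSupport (hs.iteratedFDeriv (𝕜 := ℝ) (n + d)).norm
  rw [lmarginal_univ, Finset.card_univ, Fintype.card_fin] at h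
  have hm := (EuclideanSpace.volume_preserving_symm_measurableEquiv_toLp (Fin d)).symm
  have h2 : ∫⁻ z : Fin d → ℝ, ‖iteratedFDeriv ℝ (n + d) g (WithLp.toLp 2 z)‖ₑ
      = ∫⁻ z, ‖iteratedFDeriv ℝ (n + d) g z‖ₑ :=
    hm.lintegral_comp_emb (MeasurableEquiv.measurableEmbedding _)
      (fun z => ‖iteratedFDeriv ℝ (n + d) g z‖ₑ)
  have h' : ‖iteratedFDeriv ℝ n g x‖ₑ ≤ ∫⁻ z, ‖iteratedFDeriv ℝ (n + d) g z‖ₑ := by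
    rw [← h2]; exact h
  rw [← ENNReal.ofReal_le_ofReal_iff (integral_nonneg fun _ => norm_nonneg _),
    ofReal_norm, ofReal_integral_eq_lintegral_ofReal hi (ae_of_all _ fun _ => norm_nonneg _)]
  simpa only [ofReal_norm] using h'

end Sobolev

/-! ### Bounded functionals on `L¹` of a finite measure -/

/-- A continuous functional on `L¹(μ)`, `μ` finite, is integration against a bounded function, at
least on the square integrable functions: its restriction to `L²(μ)` has a Riesz representative,
and testing with unimodular functions shows that the representative is bounded. -/
theorem exists_bounded_density {α : Type*} [MeasurableSpace α] {μ : Measure α} [IsFiniteMeasure μ]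
    {𝕜 : Type*} [RCLike 𝕜] (Λ : Lp 𝕜 1 μ →L[𝕜] 𝕜) :
    ∃ g : α → 𝕜, StronglyMeasurable g ∧ (∀ᵐ x ∂μ, ‖g x‖ ≤ ‖Λ‖) ∧
      ∀ (f : α → 𝕜) (_ : MemLp f 2 μ) (h₁ : MemLp f 1 μ), Λ (h₁.toLp f) = ∫ x, f x * g x ∂μ := by
  have h21 (f : α → 𝕜) (hf : MemLp f 2 μ) : MemLp f 1 μ :=
    hf.mono_exponent (by norm_num)
  let ι : Lp 𝕜 2 μ →ₗ[𝕜] Lp 𝕜 1 μ :=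
    { toFun := fun f => (h21 f (Lp.memLp f)).toLp f
      map_add' := fun f g => by
        rw [← MemLp.toLp_add, MemLp.toLp_eq_toLp_iff]
        exact Lp.coeFn_add f g
      map_smul' := fun c f => by
        rw [RingHom.id_apply, ← MemLp.toLp_const_smul, MemLp.toLp_eq_toLp_iff]
        exact Lp.coeFn_smul c f }
  let r : ENNReal := μ Set.univ ^ (1 / (1 : ENNReal).toReal - 1 / (2 : ENNReal).toReal)
  have hr : r ≠ ⊤ := ENNReal.rpow_ne_top_of_nonneg (by norm_num) (measure_ne_top _ _)
  have hι (f : Lp 𝕜 2 μ) : ‖ι f‖ ≤ r.toReal * ‖f‖ := by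
    have h := eLpNorm_le_eLpNorm_mul_rpow_measure_univ (p := 1) (q := 2) (by norm_num)
      (Lp.aestronglyMeasurable f)
    change ‖(h21 f (Lp.memLp f)).toLp f‖ ≤ _
    rw [Lp.norm_toLp, Lp.norm_def, mul_comm, ← ENNReal.toReal_mul]
    exact ENNReal.toReal_mono (ENNReal.mul_ne_top (Lp.eLpNorm_ne_top f) hr) h
  let h : Lp 𝕜 2 μ :=
    (InnerProductSpace.toDual 𝕜 (Lp 𝕜 2 μ)).symm (Λ ∘L ι.mkContinuous _ hι)
  have hrep (f : α → 𝕜) (hf : MemLp f 2 μ) (h₁ : MemLp f 1 μ) :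
      Λ (h₁.toLp f) = ∫ x, f x * (starRingEnd 𝕜) (h x) ∂μ := by
    have e1 : inner 𝕜 h (hf.toLp f) = Λ (ι (hf.toLp f)) :=
      InnerProductSpace.toDual_symm_apply
    have e2 : ι (hf.toLp f) = h₁.toLp f :=
      (MemLp.toLp_eq_toLp_iff (h21 _ (Lp.memLp (hf.toLp f))) h₁).mpr hf.coeFn_toLp
    rw [← e2, ← e1, L2.inner_def]
    refine integral_congr_ae ?_
    filter_upwards [hf.coeFn_toLp] with x hx
    rw [hx, RCLike.inner_apply]
  have hm : StronglyMeasurable fun x => (starRingEnd 𝕜) (h x) :=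
    RCLike.continuous_conj.comp_stronglyMeasurable (Lp.stronglyMeasurable h)
  refine ⟨_, hm, ?_, hrep⟩
  have hL2 : MemLp (h : α → 𝕜) 2 μ := Lp.memLp h
  have hint : Integrable (fun x => ‖(starRingEnd 𝕜) (h x)‖) μ := by
    simpa using (memLp_one_iff_integrable.mp (h21 _ hL2)).norm
  refine ae_le_of_forall_setIntegral_le hint (integrable_const _) fun s hs _ => ?_
  -- The phase of `h` on `s`; at the zeros of `h` its value is `0`, as `0⁻¹ = 0`.
  let u : α → 𝕜 := s.indicator fun x => ((‖h x‖ : ℝ) : 𝕜)⁻¹ * h x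
  have hu1 (x : α) : ‖u x‖ ≤ s.indicator (fun _ => (1 : ℝ)) x := by
    by_cases hx : x ∈ s
    · simp only [u, Set.indicator_of_mem hx, norm_mul, norm_inv, RCLike.norm_ofReal, abs_norm]
      exact inv_mul_le_one
    · simp [u, Set.indicator_of_notMem hx]
  have hum : AEStronglyMeasurable u μ := by
    refine (StronglyMeasurable.indicator ?_ hs).aestronglyMeasurable
    have h1 : StronglyMeasurable fun x => ((‖h x‖ : ℝ) : 𝕜)⁻¹ :=
      (RCLike.continuous_ofReal.measurable.comp
        (Lp.stronglyMeasurable h).norm.measurable).inv.stronglyMeasurable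
    exact h1.mul (Lp.stronglyMeasurable h)
  have hu1' (x : α) : ‖u x‖ ≤ 1 := (hu1 x).trans (Set.indicator_le_self' (by simp) x)
  have hu (p : ENNReal) : MemLp u p μ := MemLp.of_bound hum 1 (ae_of_all _ hu1')
  have e := hrep u (hu 2) (hu 1)
  have e3 : ∫ x, u x * (starRingEnd 𝕜) (h x) ∂μ
      = ((∫ x in s, ‖(starRingEnd 𝕜) (h x)‖ ∂μ : ℝ) : 𝕜) := by
    rw [← integral_indicator hs, ← integral_ofReal]
    refine integral_congr_ae (ae_of_all _ fun x => ?_)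
    by_cases hx : x ∈ s
    · simp only [u, Set.indicator_of_mem hx, mul_assoc, RCLike.mul_conj, RCLike.norm_conj]
      by_cases h0 : ‖h x‖ = 0
      · simp [h0]
      · field_simp
    · simp [u, Set.indicator_of_notMem hx]
  have hb := Λ.le_opNorm ((hu 1).toLp u)
  rw [e, e3, RCLike.norm_ofReal, abs_of_nonneg (integral_nonneg fun _ => norm_nonneg _)] at hb
  refine hb.trans ?_
  rw [setIntegral_const, smul_eq_mul, mul_comm]
  refine mul_le_mul_of_nonneg_right ?_ (norm_nonneg _)
  rw [L1.norm_eq_integral_norm, integral_congr_ae (g := fun x => ‖u x‖)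
    ((hu 1).coeFn_toLp.mono fun x hx => by simp [hx])]
  have := integral_mono (memLp_one_iff_integrable.mp (hu 1)).norm
    ((integrable_const (1 : ℝ)).indicator hs) hu1
  rw [integral_indicator hs] at this
  simpa using this

/-! ### Estimates for derivatives of products -/

section Leibniz

variable {E G : Type*} [NormedAddCommGroup E] [NormedSpace ℝ E] [NormedAddCommGroup G]
  [NormedSpace ℝ G]

theorem norm_iteratedFDeriv_smul_le_of_bound {h : E → ℝ} {f : E → G} (hh : ContDiff ℝ ∞ h)
    (hf : ContDiff ℝ ∞ f) {x : E} {n : ℕ} {A : ℝ}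
    (hA : ∀ i ≤ n, ‖iteratedFDeriv ℝ i h x‖ ≤ A) :
    ‖iteratedFDeriv ℝ n (fun y => h y • f y) x‖
      ≤ 2 ^ n * A * ∑ i ∈ Finset.range (n + 1), ‖iteratedFDeriv ℝ i f x‖ := by
  refine (norm_iteratedFDeriv_smul_le hh hf x (n := n) (mod_cast le_top)).trans ?_
  have hA0 : 0 ≤ A := (norm_nonneg _).trans (hA 0 (Nat.zero_le _))
  have h2 : (∑ i ∈ Finset.range (n + 1), (n.choose i : ℝ)) = 2 ^ n := by
    exact_mod_cast Nat.sum_range_choose n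
  rw [← h2, Finset.sum_mul, Finset.sum_mul]
  refine Finset.sum_le_sum fun i hi => ?_
  have hi' : i ≤ n := Nat.lt_succ_iff.mp (Finset.mem_range.mp hi)
  refine mul_le_mul (mul_le_mul_of_nonneg_left (hA i hi') (Nat.cast_nonneg _)) ?_
    (norm_nonneg _) (by positivity)
  exact Finset.single_le_sum (f := fun i => ‖iteratedFDeriv ℝ i f x‖) (fun _ _ => norm_nonneg _)
    (Finset.mem_range.mpr (Nat.lt_succ_of_le (Nat.sub_le n i)))

/-- If the derivatives of a positive function `g` at `x` are bounded by `M ^ i * g x`, then those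
of `1 / g` are bounded by a multiple of `1 / g x`, the factor depending on `M` and the order
only. -/
theorem exists_norm_iteratedFDeriv_inv_le (n : ℕ) {M : ℝ} (hM : 0 ≤ M) :
    ∃ C : ℝ, 0 ≤ C ∧ ∀ g : E → ℝ, ContDiff ℝ ∞ g → (∀ x, 0 < g x) → ∀ x,
      (∀ i ≤ n, ‖iteratedFDeriv ℝ i g x‖ ≤ M ^ i * g x) →
      ‖iteratedFDeriv ℝ n (fun y => (g y)⁻¹) x‖ ≤ C * (g x)⁻¹ := by
  let c : ℝ := ∑ i ∈ Finset.range (n + 1),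
    ‖iteratedFDerivWithin ℝ i (fun t : ℝ => t⁻¹) (Set.Ioi 0) 1‖
  have hc0 : 0 ≤ c := Finset.sum_nonneg fun _ _ => norm_nonneg _
  refine ⟨n.factorial * c * M ^ n, by positivity, fun g hg hpos x hx => ?_⟩
  have hgx := hpos x
  -- Normalize `g` to have the value `1` at `x`.
  let f : E → ℝ := fun y => (g x)⁻¹ • g y
  have hf : ContDiff ℝ ∞ f := hg.const_smul _
  have hfx : f x = 1 := by simp [f, hgx.ne']
  have hinv : ContDiffOn ℝ ∞ (fun t : ℝ => t⁻¹) (Set.Ioi 0) := fun t ht =>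
    (contDiffAt_inv ℝ (ne_of_gt ht)).contDiffWithinAt
  have h := norm_iteratedFDerivWithin_comp_le (n := n) (x := x) (C := c) (D := M)
    (s := Set.univ) (t := Set.Ioi 0) hinv hf.contDiffOn
    (mod_cast le_top) (uniqueDiffOn_Ioi 0) uniqueDiffOn_univ
    (fun y _ => by
      simp only [f, smul_eq_mul, Set.mem_Ioi]
      exact mul_pos (inv_pos.mpr hgx) (hpos y)) (Set.mem_univ x)
    (fun i hi => by
      rw [hfx]
      exact Finset.single_le_sum (f := fun i =>
        ‖iteratedFDerivWithin ℝ i (fun t : ℝ => t⁻¹) (Set.Ioi 0) 1‖)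
        (fun _ _ => norm_nonneg _) (Finset.mem_range.mpr (Nat.lt_succ_of_le hi)))
    (fun i _ hi => by
      rw [iteratedFDerivWithin_univ, iteratedFDeriv_const_smul_apply'
        (hg.of_le (mod_cast le_top)).contDiffAt, norm_smul, Real.norm_eq_abs,
        abs_of_pos (inv_pos.mpr hgx), inv_mul_le_iff₀ hgx, mul_comm]
      exact hx i hi)
  have e : (fun y => (g y)⁻¹) = (g x)⁻¹ • ((fun t : ℝ => t⁻¹) ∘ f) := by
    funext y
    have := (hpos y).ne'
    simp only [f, Pi.smul_apply, smul_eq_mul, Function.comp_apply]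
    field_simp
  have hcomp : ContDiff ℝ n ((fun t : ℝ => t⁻¹) ∘ f) := by
    have h1 : ContDiff ℝ ∞ fun y => (f y)⁻¹ := hf.inv fun y =>
      (mul_pos (inv_pos.mpr hgx) (hpos y)).ne'
    exact h1.of_le (mod_cast le_top)
  rw [iteratedFDerivWithin_univ] at h
  rw [e, iteratedFDeriv_const_smul_apply hcomp.contDiffAt, norm_smul, Real.norm_eq_abs,
    abs_of_pos (inv_pos.mpr hgx), mul_comm]
  exact mul_le_mul_of_nonneg_right h (inv_pos.mpr hgx).le

theorem norm_iteratedFDeriv_comp_const_sub (f : E → G) (y x : E) (n : ℕ) :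
    ‖iteratedFDeriv ℝ n (fun z => f (y - z)) x‖ = ‖iteratedFDeriv ℝ n f (y - x)‖ := by
  have e : (fun z => f (y - z)) =
      (fun z => f (y + z)) ∘ (LinearIsometryEquiv.neg ℝ : E ≃ₗᵢ[ℝ] E) := by
    funext z
    simp [sub_eq_add_neg]
  rw [e, LinearIsometryEquiv.norm_iteratedFDeriv_comp_right, iteratedFDeriv_comp_add_left]
  simp [sub_eq_add_neg]

end Leibniz

/-! ### The weights `ω(kx)` and `e^{-k|x|}` -/

section Omega

variable {d : ℕ}

theorem norm_le_sum_abs (x : Rd d) : ‖x‖ ≤ ∑ j, |x j| := by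
  have h := norm_sum_le Finset.univ fun j => EuclideanSpace.single j (x j)
  have e : ∑ j, EuclideanSpace.single j (x j) = x := by
    ext i
    simp [Finset.sum_apply, Pi.single_apply]
  rw [e] at h
  simpa using h

theorem exp_le_omega (k : ℕ) (x : Rd d) : Real.exp (k * ‖x‖) ≤ omega ((k : ℝ) • x) := by
  let η : Fin d → ℝ := fun j => if 0 ≤ x j then 1 else -1
  have hη : η ∈ Fintype.piFinset fun _ : Fin d => ({-1, 1} : Finset ℝ) := by
    rw [Fintype.mem_piFinset]
    intro j
    by_cases h : 0 ≤ x j <;> simp [η, h]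
  have h1 : Real.exp (k * ‖x‖) ≤ Real.exp (∑ j, η j * ((k : ℝ) • x) j) := by
    rw [Real.exp_le_exp]
    have e : ∑ j, η j * ((k : ℝ) • x) j = k * ∑ j, |x j| := by
      rw [Finset.mul_sum]
      refine Finset.sum_congr rfl fun j _ => ?_
      by_cases h : 0 ≤ x j
      · simp [η, h, abs_of_nonneg h]
      · simp [η, h, abs_of_neg (not_le.mp h)]
    rw [e]
    exact mul_le_mul_of_nonneg_left (norm_le_sum_abs x) (Nat.cast_nonneg k)
  exact h1.trans (Finset.single_le_sum
    (f := fun η : Fin d → ℝ => Real.exp (∑ j, η j * ((k : ℝ) • x) j))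
    (fun _ _ => (Real.exp_pos _).le) hη)

theorem omega_pos (x : Rd d) : 0 < omega x := by
  have := exp_le_omega 1 x
  rw [Nat.cast_one, one_smul] at this
  exact (Real.exp_pos _).trans_le this

/-- The linear functional `x ↦ k η·x`. -/
def scaledDot (k : ℕ) (η : Fin d → ℝ) : Rd d →L[ℝ] ℝ :=
  ∑ j, (η j * k) • EuclideanSpace.proj j

theorem scaledDot_apply (k : ℕ) (η : Fin d → ℝ) (x : Rd d) :
    scaledDot k η x = ∑ j, η j * ((k : ℝ) • x) j := by
  simp [scaledDot, mul_assoc]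

theorem norm_scaledDot_le (k : ℕ) {η : Fin d → ℝ}
    (hη : η ∈ Fintype.piFinset fun _ : Fin d => ({-1, 1} : Finset ℝ)) :
    ‖scaledDot k η‖ ≤ k * d := by
  refine ContinuousLinearMap.opNorm_le_bound _ (by positivity) fun x => ?_
  rw [scaledDot_apply]
  refine (norm_sum_le _ _).trans ?_
  have h : ∀ j ∈ Finset.univ, ‖η j * ((k : ℝ) • x) j‖ ≤ k * ‖x‖ := by
    intro j _
    have hj := Fintype.mem_piFinset.mp hη j
    have h1 : |η j| = 1 := by
      rcases Finset.mem_insert.mp hj with h | h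
      · simp [h]
      · simp [Finset.mem_singleton.mp h]
    rw [Real.norm_eq_abs, abs_mul, h1, one_mul, PiLp.smul_apply, smul_eq_mul, abs_mul,
      Nat.abs_cast]
    exact mul_le_mul_of_nonneg_left (PiLp.norm_apply_le x j) (Nat.cast_nonneg k)
  refine (Finset.sum_le_card_nsmul _ _ _ h).trans (le_of_eq ?_)
  simp
  ring

theorem omega_smul_eq (k : ℕ) (x : Rd d) : omega ((k : ℝ) • x) =
    ∑ η ∈ Fintype.piFinset fun _ : Fin d => ({-1, 1} : Finset ℝ), Real.exp (scaledDot k η x) := by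
  simp only [scaledDot_apply, omega]

theorem norm_iteratedFDeriv_omega_le (k n : ℕ) (x : Rd d) :
    ‖iteratedFDeriv ℝ n (fun x : Rd d => omega ((k : ℝ) • x)) x‖
      ≤ ((k : ℝ) * d) ^ n * omega ((k : ℝ) • x) := by
  simp only [omega_smul_eq]
  rw [iteratedFDeriv_sum (fun η _ => by fun_prop), Finset.sum_apply, Finset.mul_sum]
  refine (norm_sum_le _ _).trans (Finset.sum_le_sum fun η hη => ?_)
  have h := ContinuousLinearMap.iteratedFDeriv_comp_right (scaledDot k η)
    (f := Real.exp) (n := ∞) Real.contDiff_exp x (i := n) (mod_cast le_top)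
  change ‖iteratedFDeriv ℝ n (Real.exp ∘ scaledDot k η) x‖ ≤ _
  rw [h]
  refine (ContinuousMultilinearMap.norm_compContinuousLinearMap_le _ _).trans ?_
  rw [norm_iteratedFDeriv_eq_norm_iteratedDeriv, iteratedDeriv_eq_iterate, Real.iter_deriv_exp,
    Real.norm_eq_abs, Real.abs_exp, mul_comm, Finset.prod_const, Finset.card_univ,
    Fintype.card_fin]
  exact mul_le_mul_of_nonneg_right
    (pow_le_pow_left₀ (norm_nonneg _) (norm_scaledDot_le k hη) n) (Real.exp_pos _).le

theorem exists_omega_le (d k : ℕ) : ∃ C : ℝ, 0 ≤ C ∧ ∀ x : Rd d,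
    omega ((k : ℝ) • x) ≤ C * Real.exp ((k * d : ℕ) * ‖x‖) := by
  refine ⟨(Fintype.piFinset fun _ : Fin d => ({-1, 1} : Finset ℝ)).card, Nat.cast_nonneg _,
    fun x => ?_⟩
  rw [omega_smul_eq, ← nsmul_eq_mul]
  refine Finset.sum_le_card_nsmul _ _ _ fun η hη => ?_
  rw [Real.exp_le_exp]
  refine (le_abs_self _).trans (((scaledDot k η).le_opNorm x).trans ?_)
  push_cast
  exact mul_le_mul_of_nonneg_right (norm_scaledDot_le k hη) (norm_nonneg _)

theorem exists_norm_iteratedFDeriv_omega_le (d k N : ℕ) : ∃ C : ℝ, 0 ≤ C ∧ ∀ x : Rd d, ∀ n ≤ N,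
    ‖iteratedFDeriv ℝ n (fun x : Rd d => omega ((k : ℝ) • x)) x‖
      ≤ C * Real.exp ((k * d : ℕ) * ‖x‖) := by
  obtain ⟨C, hC, h⟩ := exists_omega_le d k
  refine ⟨((k : ℝ) * d + 1) ^ N * C, by positivity, fun x n hn => ?_⟩
  refine (norm_iteratedFDeriv_omega_le k n x).trans ?_
  have h0 : (0 : ℝ) ≤ k * d := by positivity
  rw [mul_assoc]
  refine mul_le_mul ?_ (h x) (omega_pos _).le (by positivity)
  exact (pow_le_pow_left₀ h0 (by linarith) n).trans (pow_le_pow_right₀ (by linarith) hn)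

theorem omega_inv_contDiff (k : ℕ) : ContDiff ℝ ∞ fun x : Rd d => (omega ((k : ℝ) • x))⁻¹ :=
  (omega_smul_contDiff k).inv fun x => (omega_pos ((k : ℝ) • x)).ne'

theorem exists_norm_iteratedFDeriv_omega_inv_le (d k N : ℕ) : ∃ C : ℝ, 0 ≤ C ∧ ∀ x : Rd d,
    ∀ n ≤ N, ‖iteratedFDeriv ℝ n (fun x : Rd d => (omega ((k : ℝ) • x))⁻¹) x‖
      ≤ C * Real.exp (-(k * ‖x‖)) := by
  have h0 : (0 : ℝ) ≤ k * d := by positivity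
  choose C hC h using fun n => exists_norm_iteratedFDeriv_inv_le (E := Rd d) n h0
  refine ⟨∑ n ∈ Finset.range (N + 1), C n, Finset.sum_nonneg fun n _ => hC n, fun x n hn => ?_⟩
  refine (h n _ (omega_smul_contDiff k) (fun x => omega_pos _) x
    fun i _ => norm_iteratedFDeriv_omega_le k i x).trans ?_
  refine mul_le_mul (Finset.single_le_sum (f := C) (fun n _ => hC n)
    (Finset.mem_range.mpr (Nat.lt_succ_of_le hn))) ?_ (inv_pos.mpr (omega_pos _)).le
    (Finset.sum_nonneg fun n _ => hC n)
  rw [Real.exp_neg]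
  exact inv_anti₀ (Real.exp_pos _) (exp_le_omega k x)

theorem integrable_exp_neg_norm : Integrable fun x : Rd d => Real.exp (-‖x‖) := by
  have h : Integrable fun x : Rd d => (1 + ‖x‖) ^ (-((d + 1 : ℕ) : ℝ)) :=
    integrable_one_add_norm (by simp)
  refine (h.const_mul ((d + 1).factorial * Real.exp 1)).mono'
    (by fun_prop) (ae_of_all _ fun x => ?_)
  have h1 : 0 ≤ 1 + ‖x‖ := by positivity
  have h2 := Real.pow_div_factorial_le_exp (1 + ‖x‖) h1 (d + 1)
  have h3 : 0 < (1 + ‖x‖) ^ (d + 1) := by positivity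
  rw [div_le_iff₀ (by positivity), Real.exp_add] at h2
  rw [Real.norm_eq_abs, Real.abs_exp, Real.rpow_neg h1, Real.rpow_natCast, Real.exp_neg,
    ← div_eq_mul_inv, le_div_iff₀ h3, inv_mul_le_iff₀ (Real.exp_pos _)]
  linarith

end Omega

/-! ### From pointwise estimates to local estimates of finite order -/

section LocalDecay

variable {d : ℕ} {𝕜 : Type*} [RCLike 𝕜]

/-- The test function `x ↦ h x • φ x`. -/
def testSMul (h : Rd d → ℝ) (hh : ContDiff ℝ ∞ h) (φ : Test d 𝕜) : Test d 𝕜 where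
  toFun x := h x • φ x
  contDiff' := hh.smul φ.contDiff
  hasCompactSupport' := φ.hasCompactSupport.mono fun x hx h0 => hx (by
    change h x • φ x = 0
    rw [h0, smul_zero])
  tsupport_subset' := fun _ _ => trivial

@[simp]
theorem testSMul_apply (h : Rd d → ℝ) (hh : ContDiff ℝ ∞ h) (φ : Test d 𝕜) (x : Rd d) :
    testSMul h hh φ x = h x • φ x := rfl

@[simp]
theorem testTranslate_apply (y : Rd d) (φ : Test d 𝕜) (x : Rd d) :
    testTranslate y φ x = φ (x + y) := rfl

@[simp]
theorem testReflect_apply (y : Rd d) (φ : Test d 𝕜) (x : Rd d) :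
    testReflect y φ x = φ (y - x) := rfl

@[simp]
theorem testMul_apply (g : Rd d → ℝ) (hg : ContDiff ℝ ∞ g) (φ : Test d 𝕜) (x : Rd d) :
    testMul g hg φ x = g x • φ x := by
  rw [RCLike.real_smul_eq_coe_mul, mul_comm]
  rfl

/-- The rigid motion `x ↦ e x + y` as a homeomorphism. -/
def motion (e : Rd d ≃ₗᵢ[ℝ] Rd d) (y : Rd d) : Rd d ≃ₜ Rd d :=
  e.toHomeomorph.trans (Homeomorph.addRight y)

theorem norm_iteratedFDeriv_comp_motion (e : Rd d ≃ₗᵢ[ℝ] Rd d) (y : Rd d) (f : Rd d → 𝕜) (n : ℕ)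
    (x : Rd d) :
    ‖iteratedFDeriv ℝ n (fun x => f (e x + y)) x‖ = ‖iteratedFDeriv ℝ n f (e x + y)‖ := by
  rw [show (fun x => f (e x + y)) = (fun z => f (z + y)) ∘ e from rfl,
    LinearIsometryEquiv.norm_iteratedFDeriv_comp_right, iteratedFDeriv_comp_add_right]

/-- Composition with the rigid motion `x ↦ e x + y` is continuous on the test functions. -/
def testMotion (e : Rd d ≃ₗᵢ[ℝ] Rd d) (y : Rd d) : Test d 𝕜 →L[𝕜] Test d 𝕜 :=
  have hs (f : Rd d → 𝕜) (hf : ContDiff ℝ ∞ f) : ContDiff ℝ ∞ fun x => f (e x + y) :=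
    hf.comp (e.contDiff.add contDiff_const)
  TestFunction.limitCLM 𝕜
    (fun φ =>
      { toFun := fun x => φ (e x + y)
        contDiff' := hs φ φ.contDiff
        hasCompactSupport' := φ.hasCompactSupport.comp_homeomorph (motion e y)
        tsupport_subset' := fun _ _ => trivial })
    (fun K _ => TestFunction.ofSupportedInCLM 𝕜 (K := ⟨motion e y ⁻¹' K,
        (motion e y).isCompact_preimage.mpr K.isCompact⟩) (fun _ _ => trivial) ∘L
      ContDiffMapSupportedIn.mkCLM 𝕜 (fun f x => f (e x + y)) (fun _ _ _ => rfl)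
        (fun _ _ _ => rfl) (fun f => hs f f.contDiff) (fun f x hx => f.zero_on_compl hx)
        (fun i hi => ⟨{i}, 1, zero_le_one, fun f x _ => by
          rw [norm_iteratedFDeriv_comp_motion, Finset.sup_singleton, one_mul]
          exact ContDiffMapSupportedIn.norm_iteratedFDeriv_apply_le_seminorm_top 𝕜⟩))
    (fun _ _ _ => rfl)

theorem testMotion_refl (y : Rd d) (φ : Test d 𝕜) :
    testMotion (LinearIsometryEquiv.refl ℝ _) y φ = testTranslate y φ := rfl

theorem testMotion_neg (y : Rd d) (φ : Test d 𝕜) :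
    testMotion (LinearIsometryEquiv.neg ℝ) y φ = testReflect y φ := by
  ext x
  change φ (-x + y) = φ (y - x)
  rw [neg_add_eq_sub]

/-- The translates `T_x φ(x + y)` decrease exponentially in `y`, uniformly for the test functions
`φ` that have support in a fixed compact set and whose derivatives up to some order are bounded. -/
def LocalDecay (T : Distr d 𝕜) : Prop :=
  ∀ (k : ℕ) (K : Compacts (Rd d)), ∃ (C : ℝ) (N : ℕ), 0 ≤ C ∧ ∀ (y : Rd d) (φ : Test d 𝕜),
    Function.support φ ⊆ K → ∀ B : ℝ, 0 ≤ B → (∀ n ≤ N, ∀ x, ‖iteratedFDeriv ℝ n φ x‖ ≤ B) →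
      ‖T (testTranslate y φ)‖ ≤ C * Real.exp (-(k * ‖y‖)) * B

/-- The weighted translates `e^{k|y|} T_x φ(x + y)` form a pointwise bounded family of
distributions. -/
theorem localDecay_of_translates {T : Distr d 𝕜}
    (hT : ∀ (φ : Test d 𝕜) (k : ℕ), ∃ C : ℝ, ∀ y,
      ‖T (testTranslate y φ)‖ * Real.exp (k * ‖y‖) ≤ C) :
    LocalDecay T := by
  intro k K
  obtain ⟨C, N, hC, h⟩ := uniform_bound_of_pointwise_bound
    (fun y : Rd d => ((Real.exp (k * ‖y‖) : ℝ) : 𝕜) •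
      (T ∘L testMotion (LinearIsometryEquiv.refl ℝ _) y))
    (fun φ => by
      obtain ⟨C, hC⟩ := hT φ k
      refine ⟨C, fun y => ?_⟩
      have := hC y
      rw [smul_apply, ContinuousLinearMap.comp_apply, testMotion_refl,
        norm_smul, RCLike.norm_ofReal, Real.abs_exp, mul_comm]
      exact this) K
  refine ⟨C, N, hC, fun y φ hφ B hB hb => ?_⟩
  have := h y φ hφ B hB hb
  rw [smul_apply, ContinuousLinearMap.comp_apply, testMotion_refl,
    norm_smul, RCLike.norm_ofReal, Real.abs_exp] at this
  rw [Real.exp_neg, mul_right_comm, ← div_eq_mul_inv, le_div_iff₀ (Real.exp_pos _), mul_comm]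
  exact this

/-- Boundedness of the convolutions `(ω(kx)T) * φ` gives the decay of `T`: one has
`T_x φ(x + y) = ((ω(kx)T) * ψ)(-y)` for a test function `ψ`, depending on `y`, whose derivatives
are of the size of `e^{-k|y|}`. -/
theorem localDecay_of_conv_omegaMul {T : Distr d 𝕜}
    (hT : ∀ (k : ℕ) (φ : Test d 𝕜), ∃ C : ℝ, ∀ y, ‖conv (omegaMul k T) φ y‖ ≤ C) :
    LocalDecay T := by
  intro k K
  let K' : Compacts (Rd d) := ⟨motion (LinearIsometryEquiv.neg ℝ) 0 ⁻¹' K,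
    (motion (LinearIsometryEquiv.neg ℝ) 0).isCompact_preimage.mpr K.isCompact⟩
  obtain ⟨C, N, hC, h⟩ := uniform_bound_of_pointwise_bound
    (fun y : Rd d => omegaMul k T ∘L testMotion (LinearIsometryEquiv.neg ℝ) y)
    (fun φ => by
      obtain ⟨C, hC⟩ := hT k φ
      refine ⟨C, fun y => ?_⟩
      rw [ContinuousLinearMap.comp_apply, testMotion_neg]
      exact hC y) K'
  obtain ⟨A, hA, hω⟩ := exists_norm_iteratedFDeriv_omega_inv_le d k N
  obtain ⟨r, hr⟩ := K.isCompact.isBounded.exists_norm_le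
  let c : ℝ := 2 ^ N * (A * Real.exp (k * r)) * (N + 1)
  have hc : 0 ≤ c := by positivity
  refine ⟨C * c, N, by positivity, fun y φ hφ B hB hb => ?_⟩
  -- The factor `g` cancels the weight: `g(x + y) = 1 / ω(kx)`.
  let g : Rd d → ℝ := fun w => (omega ((k : ℝ) • (w - y)))⁻¹
  have hg : ContDiff ℝ ∞ g := (omega_inv_contDiff k).comp (contDiff_id.sub contDiff_const)
  let ψ : Test d 𝕜 := testReflect 0 (testSMul g hg φ)
  have e : T (testTranslate y φ) = omegaMul k T (testReflect (-y) ψ) := by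
    change _ = T (testMul _ _ _)
    congr 1
    ext x
    have h1 : (0 : Rd d) - (-y - x) = x + y := by abel
    have h2 : x + y - y = x := by abel
    rw [testMul_apply, testReflect_apply, testReflect_apply, testSMul_apply, testTranslate_apply,
      h1]
    simp only [g]
    rw [h2, smul_inv_smul₀ (omega_pos _).ne']
  have hψK : Function.support ψ ⊆ K' := by
    intro x hx
    have h1 : φ (0 - x) ≠ 0 := fun h0 => hx (by
      change g (0 - x) • φ (0 - x) = 0
      rw [h0, smul_zero])
    have h2 := hφ h1
    rw [zero_sub] at h2
    change -x + 0 ∈ K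
    rwa [add_zero]
  have hψ : ∀ n ≤ N, ∀ x, ‖iteratedFDeriv ℝ n ψ x‖ ≤ c * Real.exp (-(k * ‖y‖)) * B := by
    intro n hn x
    change ‖iteratedFDeriv ℝ n (fun z => (testSMul g hg φ) (0 - z)) x‖ ≤ _
    rw [norm_iteratedFDeriv_comp_const_sub]
    set w : Rd d := 0 - x
    by_cases hw : w ∈ K
    · have hgw : ∀ i ≤ n, ‖iteratedFDeriv ℝ i g w‖
          ≤ A * Real.exp (k * r) * Real.exp (-(k * ‖y‖)) := by
        intro i hi
        have h1 : iteratedFDeriv ℝ i g w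
            = iteratedFDeriv ℝ i (fun x : Rd d => (omega ((k : ℝ) • x))⁻¹) (w - y) := by
          simp only [g, sub_eq_add_neg]
          exact iteratedFDeriv_comp_add_right
            (f := fun x : Rd d => (omega ((k : ℝ) • x))⁻¹) i (-y) w
        rw [h1, mul_assoc, ← Real.exp_add]
        refine (hω _ i (hi.trans hn)).trans (mul_le_mul_of_nonneg_left ?_ hA)
        rw [Real.exp_le_exp]
        have h2 : ‖y‖ ≤ ‖w‖ + ‖w - y‖ := by
          have := norm_sub_le w (w - y)
          rwa [sub_sub_cancel] at this
        have h3 := hr w hw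
        have h4 : (k : ℝ) * ‖y‖ ≤ k * (r + ‖w - y‖) :=
          mul_le_mul_of_nonneg_left (by linarith) (Nat.cast_nonneg k)
        linarith
      refine (norm_iteratedFDeriv_smul_le_of_bound hg φ.contDiff hgw).trans ?_
      have h5 : ∑ i ∈ Finset.range (n + 1), ‖iteratedFDeriv ℝ i φ w‖ ≤ (N + 1) * B := by
        refine (Finset.sum_le_card_nsmul _ _ B fun i hi => hb i
          ((Nat.lt_succ_iff.mp (Finset.mem_range.mp hi)).trans hn) w).trans ?_
        rw [Finset.card_range, nsmul_eq_mul]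
        refine mul_le_mul_of_nonneg_right ?_ hB
        exact_mod_cast Nat.succ_le_succ hn
      calc _ ≤ 2 ^ N * (A * Real.exp (k * r) * Real.exp (-(k * ‖y‖))) * ((N + 1) * B) := by
            refine mul_le_mul (mul_le_mul_of_nonneg_right
              (pow_le_pow_right₀ one_le_two hn) (by positivity)) h5
              (Finset.sum_nonneg fun _ _ => norm_nonneg _) (by positivity)
        _ = c * Real.exp (-(k * ‖y‖)) * B := by ring
    · have h0 : iteratedFDeriv ℝ n (testSMul g hg φ) w = 0 := by
        have hsub : tsupport (testSMul g hg φ) ⊆ K := by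
          refine closure_minimal (fun z hz => hφ fun h0 => hz ?_) K.isCompact.isClosed
          rw [testSMul_apply, h0, smul_zero]
        by_contra hne
        exact hw (hsub (support_iteratedFDeriv_subset n hne))
      rw [h0, norm_zero]
      positivity
  have := h (-y) ψ hψK _ (by positivity) hψ
  rw [ContinuousLinearMap.comp_apply, testMotion_neg, ← e] at this
  exact this.trans (le_of_eq (by ring))

end LocalDecay

/-! ### From local estimates to a global one: the partition of unity of a lattice -/

section IntegralBound

variable {d : ℕ} {𝕜 : Type*} [RCLike 𝕜]

/-- The functional `T` is bounded by the weighted integrals of finitely many derivatives, the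
weight decreasing exponentially at any given rate. -/
def IntegralBound (T : Distr d 𝕜) : Prop :=
  ∀ k : ℕ, ∃ (C : ℝ) (M : ℕ), 0 ≤ C ∧ ∀ φ : Test d 𝕜,
    ‖T φ‖ ≤ C * ∑ n ∈ Finset.range (M + 1),
      ∫ x, Real.exp (-(k * ‖x‖)) * ‖iteratedFDeriv ℝ n φ x‖

variable (d) in
/-- The function `∏_j (s(x_j + 1) - s(x_j))`, where `s` is a smooth step from `0` to `1`; its
integer translates sum to `1` because the sum telescopes in each variable. -/
def cellFun (x : Rd d) : ℝ :=
  ∏ j, (Real.smoothTransition (x j + 1) - Real.smoothTransition (x j))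

theorem cellFun_contDiff : ContDiff ℝ ∞ (cellFun d) := by
  unfold cellFun
  refine contDiff_prod fun j _ => ?_
  have hj : ContDiff ℝ ∞ fun x : Rd d => x j := by fun_prop
  exact (Real.smoothTransition.contDiff.comp (hj.add contDiff_const)).sub
    (Real.smoothTransition.contDiff.comp hj)

/-- The factor for `x_j` vanishes outside of `[-1, 1]`. -/
theorem norm_le_of_cellFun_ne_zero {x : Rd d} (hx : cellFun d x ≠ 0) : ‖x‖ ≤ d := by
  have h : ∀ j ∈ Finset.univ, |x j| ≤ 1 := by
    intro j _
    have hj := Finset.prod_ne_zero_iff.mp hx j (Finset.mem_univ j)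
    rw [abs_le]
    constructor
    · by_contra hlt
      rw [not_le] at hlt
      refine hj ?_
      rw [Real.smoothTransition.zero_of_nonpos (by linarith),
        Real.smoothTransition.zero_of_nonpos (by linarith), sub_zero]
    · by_contra hlt
      rw [not_le] at hlt
      refine hj ?_
      rw [Real.smoothTransition.one_of_one_le (by linarith),
        Real.smoothTransition.one_of_one_le (by linarith), sub_self]
  refine (norm_le_sum_abs x).trans ((Finset.sum_le_card_nsmul _ _ _ h).trans ?_)
  simp

variable (d) in
/-- `cellFun` as a test function. -/
def cell : Test d ℝ where
  toFun := cellFun d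
  contDiff' := cellFun_contDiff
  hasCompactSupport' := HasCompactSupport.intro (isCompact_closedBall (0 : Rd d) d) fun x hx => by
    by_contra h
    exact hx (mem_closedBall_zero_iff.mpr (norm_le_of_cellFun_ne_zero h))
  tsupport_subset' := fun _ _ => trivial

/-- The point `p - (R, …, R)` of the lattice `ℤ^d`. -/
def latticePoint (R : ℕ) (p : Fin d → ℕ) : Rd d := WithLp.toLp 2 fun j => (p j : ℝ) - R

/-- The lattice points with coordinates in `[-R, R]` suffice on the ball of radius `R`. -/
theorem sum_cellFun_eq_one {R : ℕ} {x : Rd d} (hx : ‖x‖ ≤ R) :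
    ∑ p ∈ Fintype.piFinset fun _ : Fin d => Finset.range (2 * R + 1),
      cellFun d (x - latticePoint R p) = 1 := by
  have h1 : ∀ p : Fin d → ℕ, cellFun d (x - latticePoint R p)
      = ∏ j, (Real.smoothTransition (x j - (p j - R) + 1)
        - Real.smoothTransition (x j - (p j - R))) := fun p => rfl
  simp only [h1]
  rw [← Finset.prod_univ_sum (fun _ : Fin d => Finset.range (2 * R + 1)) fun j i =>
    Real.smoothTransition (x j - ((i : ℝ) - R) + 1) - Real.smoothTransition (x j - ((i : ℝ) - R))]
  refine Finset.prod_eq_one fun j _ => ?_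
  have hj := abs_le.mp ((PiLp.norm_apply_le x j).trans hx)
  have h2 : ∀ i : ℕ, Real.smoothTransition (x j - ((i : ℝ) - R) + 1)
      - Real.smoothTransition (x j - ((i : ℝ) - R))
      = Real.smoothTransition (x j - ((i : ℝ) - R) + 1)
      - Real.smoothTransition (x j - (((i + 1 : ℕ) : ℝ) - R) + 1) := by
    intro i
    congr 2
    push_cast
    ring
  simp only [h2]
  rw [Finset.sum_range_sub' fun i : ℕ => Real.smoothTransition (x j - ((i : ℝ) - R) + 1),
    Real.smoothTransition.one_of_one_le (by push_cast; linarith),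
    Real.smoothTransition.zero_of_nonpos (by push_cast; linarith), sub_zero]

theorem summable_exp_neg_abs_int : Summable fun m : ℤ => Real.exp (-|(m : ℝ)|) := by
  have h : Summable fun n : ℕ => Real.exp (-(n : ℝ)) := by
    have := Real.summable_exp_nat_mul_iff (a := -1) |>.mpr (by norm_num)
    simpa using this
  refine Summable.of_nat_of_neg ?_ ?_ <;> simpa using h

theorem exists_sum_exp_latticePoint_le (d : ℕ) : ∃ S : ℝ, 0 ≤ S ∧ ∀ R : ℕ,
    ∑ p ∈ Fintype.piFinset fun _ : Fin d => Finset.range (2 * R + 1),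
      Real.exp (-(d * ‖latticePoint R p‖)) ≤ S := by
  have hs := summable_exp_neg_abs_int
  refine ⟨(∑' m : ℤ, Real.exp (-|(m : ℝ)|)) ^ d,
    pow_nonneg (tsum_nonneg fun _ => (Real.exp_pos _).le) _, fun R => ?_⟩
  have h1 : ∀ p : Fin d → ℕ, Real.exp (-(d * ‖latticePoint R p‖))
      ≤ ∏ j, Real.exp (-|(p j : ℝ) - R|) := by
    intro p
    rw [← Real.exp_sum, Real.exp_le_exp, Finset.sum_neg_distrib, neg_le_neg_iff]
    refine (Finset.sum_le_card_nsmul _ _ ‖latticePoint R p‖ fun j _ =>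
      PiLp.norm_apply_le (latticePoint R p) j).trans ?_
    simp
  refine (Finset.sum_le_sum fun p _ => h1 p).trans ?_
  rw [← Finset.prod_univ_sum (fun _ : Fin d => Finset.range (2 * R + 1)) fun _ i =>
    Real.exp (-|(i : ℝ) - R|), Finset.prod_const, Finset.card_univ, Fintype.card_fin]
  refine pow_le_pow_left₀ (Finset.sum_nonneg fun _ _ => (Real.exp_pos _).le) ?_ d
  have h2 := hs.sum_le_tsum ((Finset.range (2 * R + 1)).map
    ⟨fun i : ℕ => (i : ℤ) - R, fun a b hab => by simpa using hab⟩)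
    (fun _ _ => (Real.exp_pos _).le)
  rw [Finset.sum_map] at h2
  refine le_trans (le_of_eq (Finset.sum_congr rfl fun i _ => ?_)) h2
  change _ = Real.exp (-|(((i : ℤ) - (R : ℤ) : ℤ) : ℝ)|)
  push_cast
  rfl

theorem integrable_exp_mul_norm_iteratedFDeriv (k : ℕ) (φ : Test d 𝕜) (n : ℕ) :
    Integrable fun x => Real.exp (-(k * ‖x‖)) * ‖iteratedFDeriv ℝ n φ x‖ := by
  refine Continuous.integrable_of_hasCompactSupport ?_ ?_
  · exact (by fun_prop : Continuous fun x : Rd d => Real.exp (-(k * ‖x‖))).mul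
      (φ.contDiff.continuous_iteratedFDeriv (mod_cast le_top)).norm
  · exact (φ.hasCompactSupport.iteratedFDeriv (𝕜 := ℝ) n).norm.mul_left

/-- The derivatives of the piece of `φ` near `v`, in terms of weighted integrals of the derivatives
of `φ`. As the piece is supported near `v`, the weight `e^{-k|x|}` costs a factor `e^{k|v|}`. -/
theorem exists_norm_iteratedFDeriv_cell_le (k N : ℕ) : ∃ A : ℝ, 0 ≤ A ∧
    ∀ (φ : Test d 𝕜) (v : Rd d), ∀ n ≤ N, ∀ x,
      ‖iteratedFDeriv ℝ n (testSMul (cellFun d) cellFun_contDiff (testTranslate v φ)) x‖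
        ≤ A * Real.exp (k * ‖v‖) * ∑ i ∈ Finset.range (N + d + 1),
          ∫ x, Real.exp (-(k * ‖x‖)) * ‖iteratedFDeriv ℝ i φ x‖ := by
  choose a ha using fun n => (test_mem_weighted expWeight_continuous (cell d)).2 k n
  have ha' : ∀ n x, Real.exp (k * ‖x‖) * ‖iteratedFDeriv ℝ n (cellFun d) x‖ ≤ a n := by
    intro n x
    have := ha n ⟨x, rfl⟩
    simp only [norm_smul, expWeight, Real.norm_eq_abs, Real.abs_exp] at this
    exact this
  have ha0 : ∀ n, 0 ≤ a n := fun n => (by positivity : (0 : ℝ) ≤ _).trans (ha' n 0)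
  let A₀ : ℝ := ∑ n ∈ Finset.range (N + d + 1), a n
  have hA₀ : 0 ≤ A₀ := Finset.sum_nonneg fun n _ => ha0 n
  refine ⟨2 ^ (N + d) * A₀, by positivity, fun φ v n hn x => ?_⟩
  set g : Test d 𝕜 := testSMul (cellFun d) cellFun_contDiff (testTranslate v φ) with hg
  have hint := integrable_exp_mul_norm_iteratedFDeriv k φ
  have hpt : ∀ z, ‖iteratedFDeriv ℝ (n + d) g z‖ ≤ 2 ^ (N + d) * A₀ * Real.exp (k * ‖v‖) *
      ∑ i ∈ Finset.range (N + d + 1),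
        Real.exp (-(k * ‖z + v‖)) * ‖iteratedFDeriv ℝ i φ (z + v)‖ := by
    intro z
    have hc : ∀ i ≤ n + d, ‖iteratedFDeriv ℝ i (cellFun d) z‖ ≤ A₀ * Real.exp (-(k * ‖z‖)) := by
      intro i hi
      rw [Real.exp_neg, ← div_eq_mul_inv, le_div_iff₀ (Real.exp_pos _), mul_comm]
      exact (ha' i z).trans (Finset.single_le_sum (f := a) (fun n _ => ha0 n)
        (Finset.mem_range.mpr (by omega)))
    refine (norm_iteratedFDeriv_smul_le_of_bound cellFun_contDiff (testTranslate v φ).contDiff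
      hc).trans ?_
    have h1 : ∀ i, iteratedFDeriv ℝ i (testTranslate v φ) z = iteratedFDeriv ℝ i φ (z + v) :=
      fun i => iteratedFDeriv_comp_add_right (f := φ) i v z
    simp only [h1]
    have h2 : Real.exp (-(k * ‖z‖)) ≤ Real.exp (k * ‖v‖) * Real.exp (-(k * ‖z + v‖)) := by
      rw [← Real.exp_add, Real.exp_le_exp]
      have := mul_le_mul_of_nonneg_left (norm_add_le z v) (Nat.cast_nonneg (α := ℝ) k)
      linarith
    rw [← Finset.mul_sum, ← mul_assoc (2 ^ (N + d) * A₀ * Real.exp (k * ‖v‖))]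
    refine mul_le_mul ?_ (Finset.sum_le_sum_of_subset_of_nonneg
      (Finset.range_subset_range.mpr (by omega)) fun _ _ _ => norm_nonneg _)
      (Finset.sum_nonneg fun _ _ => norm_nonneg _) (by positivity)
    calc 2 ^ (n + d) * (A₀ * Real.exp (-(k * ‖z‖)))
        ≤ 2 ^ (N + d) * (A₀ * (Real.exp (k * ‖v‖) * Real.exp (-(k * ‖z + v‖)))) := by
          refine mul_le_mul (pow_le_pow_right₀ one_le_two (by omega))
            (mul_le_mul_of_nonneg_left h2 hA₀) (by positivity) (by positivity)
      _ = _ := by ring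
  have hint' : ∀ i ∈ Finset.range (N + d + 1), Integrable fun z =>
      Real.exp (-(k * ‖z + v‖)) * ‖iteratedFDeriv ℝ i φ (z + v)‖ := fun i _ =>
    (hint i).comp_add_right v
  have hgi : Integrable fun z => ‖iteratedFDeriv ℝ (n + d) g z‖ :=
    ((g.contDiff.continuous_iteratedFDeriv (mod_cast le_top)).norm).integrable_of_hasCompactSupport
      (g.hasCompactSupport.iteratedFDeriv (𝕜 := ℝ) (n + d)).norm
  refine (norm_iteratedFDeriv_le_integral g.contDiff g.hasCompactSupport n x).trans
    ((integral_mono hgi ((integrable_finsetSum _ hint').const_mul _) hpt).trans (le_of_eq ?_))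
  rw [integral_const_mul, integral_finsetSum _ hint']
  congr 1
  refine Finset.sum_congr rfl fun i _ => ?_
  exact integral_add_right_eq_self
    (fun z => Real.exp (-(k * ‖z‖)) * ‖iteratedFDeriv ℝ i φ z‖) v

/-- Local decay implies the global bound: cut `φ` into the pieces of a partition of unity. -/
theorem LocalDecay.integralBound {T : Distr d 𝕜} (hT : LocalDecay T) : IntegralBound T := by
  intro k
  -- The additional decay `e^{-d|v|}` serves to sum over the lattice points `v`.
  obtain ⟨C, N, hC, h⟩ := hT (k + d) ⟨Metric.closedBall 0 d, isCompact_closedBall _ _⟩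
  obtain ⟨A, hA, hA'⟩ := exists_norm_iteratedFDeriv_cell_le (d := d) (𝕜 := 𝕜) k N
  obtain ⟨S, hS, hS'⟩ := exists_sum_exp_latticePoint_le d
  refine ⟨C * A * S, N + d, by positivity, fun φ => ?_⟩
  set Q : ℝ := ∑ n ∈ Finset.range (N + d + 1),
      ∫ x, Real.exp (-(k * ‖x‖)) * ‖iteratedFDeriv ℝ n φ x‖ with hQ
  have hQ0 : 0 ≤ Q := Finset.sum_nonneg fun n _ => integral_nonneg fun x => by positivity
  obtain ⟨r, hr⟩ := φ.hasCompactSupport.isCompact.isBounded.exists_norm_le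
  obtain ⟨R, hR⟩ := exists_nat_ge r
  let piece (p : Fin d → ℕ) : Test d 𝕜 :=
    testSMul (cellFun d) cellFun_contDiff (testTranslate (latticePoint R p) φ)
  have hsum : φ = ∑ p ∈ Fintype.piFinset fun _ : Fin d => Finset.range (2 * R + 1),
      testTranslate (-latticePoint R p) (piece p) := by
    ext x
    rw [FunLike.coe_sum, Finset.sum_apply]
    have h1 : ∀ p, testTranslate (-latticePoint R p) (piece p) x
        = cellFun d (x - latticePoint R p) • φ x := by
      intro p
      change cellFun d (x + -latticePoint R p) • φ (x + -latticePoint R p + latticePoint R p) = _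
      rw [neg_add_cancel_right, ← sub_eq_add_neg]
    simp only [h1]
    rw [← Finset.sum_smul]
    by_cases hx : φ x = 0
    · rw [hx, smul_zero]
    · rw [sum_cellFun_eq_one ((hr x (subset_tsupport φ hx)).trans hR), one_smul]
  have hpiece : ∀ p, ‖T (testTranslate (-latticePoint R p) (piece p))‖
      ≤ C * A * Q * Real.exp (-(d * ‖latticePoint R p‖)) := by
    intro p
    have hsupp : Function.support (piece p) ⊆ Metric.closedBall 0 (d : ℝ) := by
      intro x hx
      refine mem_closedBall_zero_iff.mpr (norm_le_of_cellFun_ne_zero fun h0 => hx ?_)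
      change cellFun d x • testTranslate (latticePoint R p) φ x = 0
      rw [h0, zero_smul]
    refine (h (-latticePoint R p) (piece p) hsupp _ (by positivity)
      (hA' φ (latticePoint R p))).trans (le_of_eq ?_)
    have e : Real.exp (-(d * ‖latticePoint R p‖))
        = Real.exp (-(((k + d : ℕ) : ℝ) * ‖-latticePoint R p‖))
          * Real.exp (k * ‖latticePoint R p‖) := by
      rw [← Real.exp_add, norm_neg]
      congr 1
      push_cast
      ring
    rw [e]
    ring
  calc ‖T φ‖ = ‖∑ p ∈ Fintype.piFinset fun _ : Fin d => Finset.range (2 * R + 1),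
        T (testTranslate (-latticePoint R p) (piece p))‖ := by
        conv_lhs => rw [hsum, map_sum]
    _ ≤ ∑ p ∈ Fintype.piFinset fun _ : Fin d => Finset.range (2 * R + 1),
        C * A * Q * Real.exp (-(d * ‖latticePoint R p‖)) :=
        norm_sum_le_of_le _ fun p _ => hpiece p
    _ ≤ C * A * Q * S := by
        rw [← Finset.mul_sum]
        exact mul_le_mul_of_nonneg_left (hS' R) (by positivity)
    _ = C * A * S * Q := by ring

end IntegralBound

/-! ### Representation by bounded densities -/

section Representation

variable {d : ℕ} {𝕜 : Type*} [RCLike 𝕜]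

/-- The words of length at most `M` in the coordinates; they index the partial derivatives of
order at most `M`, with repetitions. -/
abbrev Tuple (d M : ℕ) : Type := Σ n : Fin (M + 1), Fin n → Fin d

/-- The partial derivative of `f` that is given by the word `i`. -/
def tupleDeriv {M : ℕ} (i : Tuple d M) (f : Rd d → 𝕜) (x : Rd d) : 𝕜 :=
  iteratedFDeriv ℝ i.1 f x fun l => EuclideanSpace.single (i.2 l) (1 : ℝ)

theorem norm_apply_single_le {n : ℕ} (A : (Rd d) [×n]→L[ℝ] 𝕜) (i : Fin n → Fin d) :
    ‖A fun l => EuclideanSpace.single (i l) (1 : ℝ)‖ ≤ ‖A‖ := by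
  refine (A.le_opNorm _).trans (le_of_eq ?_)
  simp

theorem norm_le_sum_norm_apply_single {n : ℕ} (A : (Rd d) [×n]→L[ℝ] 𝕜) :
    ‖A‖ ≤ ∑ i : Fin n → Fin d, ‖A fun l => EuclideanSpace.single (i l) (1 : ℝ)‖ := by
  refine ContinuousMultilinearMap.opNorm_le_bound (Finset.sum_nonneg fun _ _ => norm_nonneg _)
    fun v => ?_
  have e : v = fun l => ∑ j, v l j • EuclideanSpace.single j (1 : ℝ) := by
    funext l
    ext i
    simp [Finset.sum_apply, Pi.single_apply]
  have h : A v = ∑ i : Fin n → Fin d,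
      (∏ l, v l (i l)) • A fun l => EuclideanSpace.single (i l) (1 : ℝ) := by
    conv_lhs => rw [e]
    rw [ContinuousMultilinearMap.map_sum]
    exact Finset.sum_congr rfl fun i _ => A.toMultilinearMap.map_smul_univ _ _
  rw [h, Finset.sum_mul]
  refine norm_sum_le_of_le _ fun i _ => ?_
  rw [norm_smul, mul_comm, norm_prod]
  exact mul_le_mul_of_nonneg_left (Finset.prod_le_prod (fun _ _ => norm_nonneg _)
    fun l _ => PiLp.norm_apply_le (v l) (i l)) (norm_nonneg _)

theorem norm_tupleDeriv_le {M : ℕ} (i : Tuple d M) (f : Rd d → 𝕜) (x : Rd d) :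
    ‖tupleDeriv i f x‖ ≤ ‖iteratedFDeriv ℝ i.1 f x‖ :=
  norm_apply_single_le _ _

theorem continuous_tupleDeriv {M : ℕ} (i : Tuple d M) {f : Rd d → 𝕜} (hf : ContDiff ℝ ∞ f) :
    Continuous (tupleDeriv i f) :=
  (ContinuousMultilinearMap.apply ℝ (fun _ : Fin i.1 => Rd d) 𝕜 _).continuous.comp
    (hf.continuous_iteratedFDeriv (mod_cast le_top))

theorem tupleDeriv_add {M : ℕ} (i : Tuple d M) {f g : Rd d → 𝕜} (hf : ContDiff ℝ ∞ f)
    (hg : ContDiff ℝ ∞ g) (x : Rd d) :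
    tupleDeriv i (f + g) x = tupleDeriv i f x + tupleDeriv i g x := by
  unfold tupleDeriv
  rw [iteratedFDeriv_add_apply (hf.of_le (mod_cast le_top)).contDiffAt
    (hg.of_le (mod_cast le_top)).contDiffAt]
  rfl

theorem tupleDeriv_smul {M : ℕ} (i : Tuple d M) (c : 𝕜) {f : Rd d → 𝕜} (hf : ContDiff ℝ ∞ f)
    (x : Rd d) : tupleDeriv i (c • f) x = c • tupleDeriv i f x := by
  unfold tupleDeriv
  rw [iteratedFDeriv_const_smul_apply (hf.of_le (mod_cast le_top)).contDiffAt]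
  rfl

/-- For every rate of exponential decay, the distribution `T` is a sum of derivatives of functions
that decrease at this rate; the derivatives are transferred to the test function. -/
def Represented (T : Distr d 𝕜) : Prop :=
  ∀ k : ℕ, ∃ (M : ℕ) (t : Tuple d M → Rd d → 𝕜) (C : ℝ), (∀ i, AEStronglyMeasurable (t i) volume) ∧
    (∀ i, ∀ᵐ x, ‖t i x‖ ≤ C * Real.exp (-(k * ‖x‖))) ∧
    ∀ φ : Test d 𝕜, T φ = ∑ i, ∫ x, tupleDeriv i φ x * t i x

/-- A linear functional that is bounded by the norm of `J v` factors through `J` and a continuous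
functional, by the Hahn–Banach theorem. -/
theorem exists_factor_of_norm_le {V W : Type*} [AddCommGroup V] [Module 𝕜 V]
    [NormedAddCommGroup W] [NormedSpace 𝕜 W] (J : V →ₗ[𝕜] W) (T : V →ₗ[𝕜] 𝕜) {C : ℝ}
    (h : ∀ v, ‖T v‖ ≤ C * ‖J v‖) : ∃ Λ : W →L[𝕜] 𝕜, ∀ v, Λ (J v) = T v := by
  obtain ⟨s, hs⟩ := LinearMap.exists_rightInverse_of_surjective J.rangeRestrict
    (LinearMap.range_rangeRestrict J)
  have hs' (w : LinearMap.range J) : J (s w) = w := congrArg Subtype.val (LinearMap.congr_fun hs w)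
  let f : LinearMap.range J →L[𝕜] 𝕜 := (T ∘ₗ s).mkContinuous C fun w => by
    have := h (s w)
    rwa [hs'] at this
  obtain ⟨Λ, hΛ, -⟩ := exists_extension_norm_eq (LinearMap.range J) f
  refine ⟨Λ, fun v => ?_⟩
  have h1 : Λ (J v) = T (s (J.rangeRestrict v)) := hΛ (J.rangeRestrict v)
  have h2 : J (s (J.rangeRestrict v) - v) = 0 := by
    rw [map_sub, hs', sub_eq_zero]
    rfl
  have h3 := h (s (J.rangeRestrict v) - v)
  rw [h2, norm_zero, mul_zero, norm_le_zero_iff, map_sub, sub_eq_zero] at h3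
  rw [h1, h3]

variable (d) in
/-- The measure `e^{-(k+1)|x|} dx`; the exponent `k + 1` makes it finite for every `k`. -/
def expMeasure (k : ℕ) : Measure (Rd d) :=
  volume.withDensity fun x => ENNReal.ofReal (Real.exp (-((k + 1 : ℕ) * ‖x‖)))

theorem integrable_exp_neg_succ_mul_norm (k : ℕ) :
    Integrable fun x : Rd d => Real.exp (-((k + 1 : ℕ) * ‖x‖)) := by
  refine integrable_exp_neg_norm.mono' (by fun_prop) (ae_of_all _ fun x => ?_)
  rw [Real.norm_eq_abs, Real.abs_exp, Real.exp_le_exp, neg_le_neg_iff]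
  push_cast
  nlinarith [norm_nonneg x, Nat.cast_nonneg (α := ℝ) k]

instance isFiniteMeasure_expMeasure (k : ℕ) : IsFiniteMeasure (expMeasure d k) :=
  isFiniteMeasure_withDensity_ofReal (integrable_exp_neg_succ_mul_norm k).2

theorem integral_expMeasure {G : Type*} [NormedAddCommGroup G] [NormedSpace ℝ G] (k : ℕ)
    (f : Rd d → G) :
    ∫ x, f x ∂expMeasure d k = ∫ x, Real.exp (-((k + 1 : ℕ) * ‖x‖)) • f x := by
  unfold expMeasure
  rw [integral_withDensity_eq_integral_toReal_smul (by fun_prop)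
    (ae_of_all _ fun _ => ENNReal.ofReal_lt_top)]
  simp only [ENNReal.toReal_ofReal (Real.exp_pos _).le]

theorem ae_expMeasure_iff (k : ℕ) (p : Rd d → Prop) :
    (∀ᵐ x ∂expMeasure d k, p x) ↔ ∀ᵐ x, p x := by
  unfold expMeasure
  rw [ae_withDensity_iff (by fun_prop)]
  refine Filter.eventually_congr (ae_of_all _ fun x => ?_)
  simp [Real.exp_pos]

theorem memLp_tupleDeriv {M : ℕ} (i : Tuple d M) (φ : Test d 𝕜) (p : ENNReal) (k : ℕ) :
    MemLp (tupleDeriv i φ) p (expMeasure d k) := by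
  have hc := continuous_tupleDeriv i φ.contDiff
  obtain ⟨C, hC⟩ := (φ.contDiff.continuous_iteratedFDeriv (m := i.1)
    (mod_cast le_top)).bounded_above_of_compact_support
    (φ.hasCompactSupport.iteratedFDeriv (𝕜 := ℝ) i.1)
  exact MemLp.of_bound hc.aestronglyMeasurable C
    (ae_of_all _ fun x => (norm_tupleDeriv_le i φ x).trans (hC x))

/-- The partial derivatives of order at most `M` as elements of a weighted `L¹`. -/
def jet (M k : ℕ) : Test d 𝕜 →ₗ[𝕜] (Tuple d M → Lp 𝕜 1 (expMeasure d k)) where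
  toFun φ i := (memLp_tupleDeriv i φ 1 k).toLp _
  map_add' φ ψ := by
    funext i
    rw [Pi.add_apply, ← MemLp.toLp_add, MemLp.toLp_eq_toLp_iff]
    exact ae_of_all _ fun x => tupleDeriv_add i φ.contDiff ψ.contDiff x
  map_smul' c φ := by
    funext i
    rw [RingHom.id_apply, Pi.smul_apply, ← MemLp.toLp_const_smul, MemLp.toLp_eq_toLp_iff]
    exact ae_of_all _ fun x => tupleDeriv_smul i c φ.contDiff x

theorem norm_jet_apply {M k : ℕ} (φ : Test d 𝕜) (i : Tuple d M) :
    ‖jet M k φ i‖ = ∫ x, Real.exp (-((k + 1 : ℕ) * ‖x‖)) * ‖tupleDeriv i φ x‖ := by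
  change ‖(memLp_tupleDeriv i φ 1 k).toLp _‖ = _
  rw [L1.norm_eq_integral_norm, integral_congr_ae (g := fun x => ‖tupleDeriv i φ x‖)
    ((memLp_tupleDeriv i φ 1 k).coeFn_toLp.mono fun x hx => by simp [hx]), integral_expMeasure]
  rfl

theorem sum_integral_le_norm_jet (M k : ℕ) (φ : Test d 𝕜) :
    ∑ n ∈ Finset.range (M + 1),
        ∫ x, Real.exp (-((k + 1 : ℕ) * ‖x‖)) * ‖iteratedFDeriv ℝ n φ x‖
      ≤ Fintype.card (Tuple d M) * ‖jet M k φ‖ := by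
  have h1 : ∑ n ∈ Finset.range (M + 1),
      ∫ x, Real.exp (-((k + 1 : ℕ) * ‖x‖)) * ‖iteratedFDeriv ℝ n φ x‖
      ≤ ∑ i : Tuple d M, ‖jet M k φ i‖ := by
    rw [Finset.sum_range, Fintype.sum_sigma]
    refine Finset.sum_le_sum fun n _ => ?_
    have hi : ∀ i ∈ (Finset.univ : Finset (Fin n → Fin d)), Integrable fun x =>
        Real.exp (-((k + 1 : ℕ) * ‖x‖)) * ‖tupleDeriv (⟨n, i⟩ : Tuple d M) φ x‖ := by
      intro i _
      refine (integrable_exp_mul_norm_iteratedFDeriv (k + 1) φ n).mono' ?_ (ae_of_all _ fun x => ?_)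
      · exact ((by fun_prop : Continuous fun x : Rd d => Real.exp (-((k + 1 : ℕ) * ‖x‖))).mul
          (continuous_tupleDeriv _ φ.contDiff).norm).aestronglyMeasurable
      · rw [norm_mul, norm_norm, Real.norm_eq_abs, Real.abs_exp]
        exact mul_le_mul_of_nonneg_left (norm_tupleDeriv_le _ _ _) (Real.exp_pos _).le
    simp only [norm_jet_apply]
    rw [← integral_finsetSum _ hi]
    refine integral_mono (integrable_exp_mul_norm_iteratedFDeriv (k + 1) φ n)
      (integrable_finsetSum _ hi) fun x => ?_
    change _ * _ ≤ _
    rw [← Finset.mul_sum]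
    exact mul_le_mul_of_nonneg_left (norm_le_sum_norm_apply_single _) (Real.exp_pos _).le
  refine h1.trans ((Finset.sum_le_card_nsmul _ _ ‖jet M k φ‖ fun i _ =>
    norm_le_pi_norm _ i).trans (le_of_eq ?_))
  rw [Finset.card_univ, nsmul_eq_mul]

/-- The bound makes `T` a bounded functional of the jet in a weighted `L¹`; the weight of the
measure becomes the decay of the densities. -/
theorem IntegralBound.represented {T : Distr d 𝕜} (hT : IntegralBound T) : Represented T := by
  classical
  intro k
  obtain ⟨C, M, hC, h⟩ := hT (k + 1)
  obtain ⟨Λ, hΛ⟩ := exists_factor_of_norm_le (jet M k) T.toLinearMap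
    (C := C * Fintype.card (Tuple d M)) fun φ => by
      rw [mul_assoc]
      exact (h φ).trans (mul_le_mul_of_nonneg_left (sum_integral_le_norm_jet M k φ) hC)
  let Λ' : Tuple d M → Lp 𝕜 1 (expMeasure d k) →L[𝕜] 𝕜 := fun i =>
    Λ ∘L ContinuousLinearMap.single 𝕜 (fun _ : Tuple d M => Lp 𝕜 1 (expMeasure d k)) i
  choose g hgm hgb hg using fun i => exists_bounded_density (Λ' i)
  refine ⟨M, fun i x => Real.exp (-((k + 1 : ℕ) * ‖x‖)) • g i x, ∑ i, ‖Λ' i‖, fun i => ?_,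
    fun i => ?_, fun φ => ?_⟩
  · exact ((by fun_prop : Continuous fun x : Rd d =>
      Real.exp (-((k + 1 : ℕ) * ‖x‖))).stronglyMeasurable.smul (hgm i)).aestronglyMeasurable
  · filter_upwards [(ae_expMeasure_iff k _).mp (hgb i)] with x hx
    rw [norm_smul, Real.norm_eq_abs, Real.abs_exp, mul_comm]
    refine mul_le_mul (hx.trans (Finset.single_le_sum (f := fun i => ‖Λ' i‖)
      (fun _ _ => norm_nonneg _) (Finset.mem_univ i))) ?_ (Real.exp_pos _).le
      (Finset.sum_nonneg fun _ _ => norm_nonneg _)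
    rw [Real.exp_le_exp, neg_le_neg_iff]
    push_cast
    nlinarith [norm_nonneg x]
  · have h1 : T φ = ∑ i, Λ' i (jet M k φ i) := by
      rw [show T φ = Λ (jet M k φ) from (hΛ φ).symm]
      exact (ContinuousLinearMap.sum_comp_single 𝕜
        (fun _ : Tuple d M => Lp 𝕜 1 (expMeasure d k)) Λ (jet M k φ)).symm
    rw [h1]
    refine Finset.sum_congr rfl fun i _ => ?_
    refine (hg i _ (memLp_tupleDeriv i φ 2 k) (memLp_tupleDeriv i φ 1 k)).trans ?_
    rw [integral_expMeasure]
    simp only [mul_smul_comm]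

end Representation

/-! ### Words of derivatives and multi-indices -/

section MultiIndex

variable {d : ℕ} {𝕜 : Type*} [RCLike 𝕜]

/-- The iterated partial derivative `∂_{w_1} ∂_{w_2} ⋯ φ` of a test function. -/
def wordDeriv (w : List (Fin d)) (φ : Test d 𝕜) : Test d 𝕜 :=
  w.foldr (fun j ψ => ∂_{EuclideanSpace.single j (1 : ℝ)} ψ) φ

theorem lineDerivOp_test_apply (v : Rd d) (φ : Test d 𝕜) (x : Rd d) :
    (∂_{v} φ) x = fderiv ℝ φ x v := by
  change TestFunction.fderivCLM ℝ ⊤ ⊤ φ x v = _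
  rw [TestFunction.fderivCLM_apply_of_le _ le_top]

theorem lineDerivOp_test_comm (v w : Rd d) (φ : Test d 𝕜) : ∂_{v} (∂_{w} φ) = ∂_{w} (∂_{v} φ) := by
  ext x
  have hφ : ContDiff ℝ ∞ (fderiv ℝ φ) := φ.contDiff.fderiv_right (by simp)
  have hd : DifferentiableAt ℝ (fderiv ℝ φ) x := hφ.differentiable (by simp) x
  have h : ∀ a b : Rd d, (∂_{a} (∂_{b} φ)) x = fderiv ℝ (fderiv ℝ φ) x a b := by
    intro a b
    rw [lineDerivOp_test_apply]
    have e : (⇑(∂_{b} φ : Test d 𝕜) : Rd d → 𝕜) = fun y => fderiv ℝ φ y b :=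
      funext fun y => lineDerivOp_test_apply b φ y
    rw [e, fderiv_clm_apply hd (differentiableAt_const b)]
    simp
  rw [h, h]
  exact second_derivative_symmetric (fun y => (φ.contDiff.differentiable (by simp) y).hasFDerivAt)
    hd.hasFDerivAt v w

theorem wordDeriv_perm {w w' : List (Fin d)} (h : w.Perm w') (φ : Test d 𝕜) :
    wordDeriv w φ = wordDeriv w' φ := by
  have : LeftCommutative fun (j : Fin d) (ψ : Test d 𝕜) =>
      ∂_{EuclideanSpace.single j (1 : ℝ)} ψ := ⟨fun _ _ ψ => lineDerivOp_test_comm _ _ ψ⟩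
  exact h.foldr_eq φ

theorem wordDeriv_append (w w' : List (Fin d)) (φ : Test d 𝕜) :
    wordDeriv (w ++ w') φ = wordDeriv w (wordDeriv w' φ) :=
  List.foldr_append

theorem wordDeriv_ofFn_apply {n : ℕ} (i : Fin n → Fin d) (φ : Test d 𝕜) (x : Rd d) :
    wordDeriv (List.ofFn i) φ x
      = iteratedFDeriv ℝ n φ x fun l => EuclideanSpace.single (i l) (1 : ℝ) := by
  induction n generalizing x with
  | zero =>
    rw [iteratedFDeriv_zero_apply]
    rfl
  | succ n ih =>
    rw [List.ofFn_succ, iteratedFDeriv_succ_apply_left]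
    change (∂_{EuclideanSpace.single (i 0) (1 : ℝ)} (wordDeriv _ φ)) x = _
    rw [lineDerivOp_test_apply, funext (ih fun l => i l.succ)]
    exact fderiv_continuousMultilinear_apply_const_apply
      ((φ.contDiff.differentiable_iteratedFDeriv (mod_cast WithTop.coe_lt_top _)) x) _ _

theorem norm_wordDeriv_le (w : List (Fin d)) (φ : Test d 𝕜) (x : Rd d) :
    ‖wordDeriv w φ x‖ ≤ ‖iteratedFDeriv ℝ w.length φ x‖ := by
  have h := wordDeriv_ofFn_apply w.get φ x
  rw [List.ofFn_get] at h
  rw [h]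
  exact norm_apply_single_le _ _

theorem partialDeriv_iterate_apply (j : Fin d) (b : ℕ) (S : Distr d 𝕜) (φ : Test d 𝕜) :
    ((partialDeriv j)^[b] S) φ = (-1) ^ b * S (wordDeriv (List.replicate b j) φ) := by
  induction b generalizing S with
  | zero => simp [wordDeriv]
  | succ b ih =>
    rw [Function.iterate_succ_apply, ih]
    change _ * -(S (∂_{EuclideanSpace.single j (1 : ℝ)} (wordDeriv (List.replicate b j) φ))) = _
    rw [List.replicate_succ, pow_succ]
    change _ = _ * S (∂_{EuclideanSpace.single j (1 : ℝ)} (wordDeriv (List.replicate b j) φ))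
    ring

/-- The word `1^{β_1} ⋯ d^{β_d}`. -/
def multiWord (β : Fin d → ℕ) : List (Fin d) :=
  (List.finRange d).flatMap fun j => List.replicate (β j) j

theorem multiDeriv_apply (β : Fin d → ℕ) (T : Distr d 𝕜) (φ : Test d 𝕜) :
    multiDeriv β T φ = (-1) ^ (multiWord β).length * T (wordDeriv (multiWord β) φ) := by
  unfold multiDeriv multiWord
  induction List.finRange d generalizing φ with
  | nil => simp [wordDeriv]
  | cons j l ih =>
    rw [List.foldr_cons, partialDeriv_iterate_apply, ih, List.flatMap_cons, ← wordDeriv_append,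
      wordDeriv_perm List.perm_append_comm, List.length_append, List.length_replicate, pow_add]
    ring

theorem count_multiWord (β : Fin d → ℕ) (j : Fin d) : (multiWord β).count j = β j := by
  unfold multiWord
  rw [List.count_flatMap]
  have : (List.count j ∘ fun l => List.replicate (β l) l) = fun l => if l = j then β l else 0 := by
    funext l
    simp [List.count_replicate]
  rw [this, ← List.ofFn_eq_map, List.sum_ofFn]
  simp

/-- Mixed partial derivatives depend on the number of occurrences of each letter only. -/
theorem wordDeriv_multiWord_apply {M : ℕ} (i : Tuple d M) (φ : Test d 𝕜) (x : Rd d) :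
    wordDeriv (multiWord fun j => (List.ofFn i.2).count j) φ x = tupleDeriv i φ x := by
  have h : (multiWord fun j => (List.ofFn i.2).count j).Perm (List.ofFn i.2) :=
    List.perm_iff_count.mpr fun j => count_multiWord _ j
  rw [wordDeriv_perm h]
  exact wordDeriv_ofFn_apply i.2 φ x

theorem ofFun_apply {t : Rd d → 𝕜} (ht : MemLp t ⊤ volume) (φ : Test d 𝕜) :
    ofFun t φ = ∫ x, φ x * t x :=
  TestFunction.integralAgainstBilinCLM_eq_integral
    ((ht.locallyIntegrable le_top).locallyIntegrableOn _)

theorem integrable_test_mul {t : Rd d → 𝕜} (ht : MemLp t ⊤ volume) (φ : Test d 𝕜) :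
    Integrable fun x => φ x * t x :=
  TestFunction.integrable_bilin (ContinuousLinearMap.mul 𝕜 𝕜)
    ((ht.locallyIntegrable le_top).locallyIntegrableOn _) φ

theorem norm_le_of_memLp_exp_smul {k : ℕ} {t : Rd d → 𝕜}
    (ht : MemLp (fun x => Real.exp (k * ‖x‖) • t x) ⊤ volume) :
    ∃ C : ℝ, 0 ≤ C ∧ ∀ᵐ x, ‖t x‖ ≤ C * Real.exp (-(k * ‖x‖)) := by
  refine ⟨(eLpNormEssSup (fun x => Real.exp (k * ‖x‖) • t x) volume).toReal,
    ENNReal.toReal_nonneg, ?_⟩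
  filter_upwards [ae_le_eLpNormEssSup (f := fun x => Real.exp (k * ‖x‖) • t x)] with x hx
  rw [Real.exp_neg, ← div_eq_mul_inv, le_div_iff₀ (Real.exp_pos _), mul_comm]
  have h := ENNReal.toReal_mono (by rw [← eLpNorm_exponent_top]; exact ht.2.ne) hx
  rwa [toReal_enorm, norm_smul, Real.norm_eq_abs, Real.abs_exp] at h

theorem memLp_of_memLp_exp_smul {k : ℕ} {t : Rd d → 𝕜}
    (ht : MemLp (fun x => Real.exp (k * ‖x‖) • t x) ⊤ volume) : MemLp t ⊤ volume := by
  obtain ⟨C, hC, h⟩ := norm_le_of_memLp_exp_smul ht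
  refine memLp_top_of_bound ?_ C ?_
  · have e : t = fun x => Real.exp (-(k * ‖x‖)) • (Real.exp (k * ‖x‖) • t x) := by
      funext x
      rw [smul_smul, ← Real.exp_add, neg_add_cancel, Real.exp_zero, one_smul]
    rw [e]
    exact (by fun_prop : Continuous fun x : Rd d =>
      Real.exp (-(k * ‖x‖))).aestronglyMeasurable.smul ht.1
  · filter_upwards [h] with x hx
    refine hx.trans (mul_le_of_le_one_right hC ?_)
    rw [Real.exp_le_one_iff, neg_nonpos]
    positivity

/-- The densities of all the words with the same letter counts are added up, with the sign of the
integration by parts. -/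
theorem Represented.eq_sum_multiDeriv {T : Distr d 𝕜} (hT : Represented T) (k : ℕ) :
    ∃ (F : Finset (Fin d → ℕ)) (t : (Fin d → ℕ) → Rd d → 𝕜),
      (∀ β ∈ F, MemLp (fun x => Real.exp (k * ‖x‖) • t β x) ⊤ volume) ∧
      T = ∑ β ∈ F, multiDeriv β (ofFun (t β)) := by
  classical
  obtain ⟨M, t, C, htm, htC, hrep⟩ := hT k
  let c : Tuple d M → Fin d → ℕ := fun i j => (List.ofFn i.2).count j
  let s : (Fin d → ℕ) → Rd d → 𝕜 := fun β x =>
    ∑ i with c i = β, (-1) ^ (multiWord β).length * t i x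
  have ht : ∀ i, MemLp (fun x => Real.exp (k * ‖x‖) • t i x) ⊤ volume := by
    intro i
    refine memLp_top_of_bound ((by fun_prop : Continuous fun x : Rd d =>
      Real.exp (k * ‖x‖)).aestronglyMeasurable.smul (htm i)) C ?_
    filter_upwards [htC i] with x hx
    rw [Real.exp_neg, ← div_eq_mul_inv, le_div_iff₀ (Real.exp_pos _), mul_comm] at hx
    rwa [norm_smul, Real.norm_eq_abs, Real.abs_exp]
  have hs : ∀ β, MemLp (fun x => Real.exp (k * ‖x‖) • s β x) ⊤ volume := by
    intro β
    have e : (fun x => Real.exp (k * ‖x‖) • s β x) = fun x => ∑ i with c i = β,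
        (-1) ^ (multiWord β).length * (Real.exp (k * ‖x‖) • t i x) := by
      funext x
      simp only [s, Finset.smul_sum, mul_smul_comm]
    rw [e]
    exact memLp_finsetSum _ fun i _ => (ht i).const_mul _
  refine ⟨Finset.univ.image c, s, fun β _ => hs β, ?_⟩
  ext φ
  rw [sum_apply, hrep φ, ← Finset.sum_fiberwise_of_maps_to
    (g := c) (t := Finset.univ.image c) (fun i _ => Finset.mem_image_of_mem c (Finset.mem_univ i))]
  refine Finset.sum_congr rfl fun β _ => ?_
  rw [multiDeriv_apply, ofFun_apply (memLp_of_memLp_exp_smul (hs β)), ← integral_const_mul]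
  have hi : ∀ i ∈ Finset.univ.filter (fun i => c i = β),
      Integrable fun x => tupleDeriv i φ x * t i x := by
    intro i _
    refine (integrable_test_mul (memLp_of_memLp_exp_smul (ht i))
      (wordDeriv (multiWord (c i)) φ)).congr (ae_of_all _ fun x => ?_)
    change wordDeriv (multiWord (c i)) φ x * t i x = _
    rw [wordDeriv_multiWord_apply]
  rw [← integral_finsetSum _ hi]
  refine integral_congr_ae (ae_of_all _ fun x => ?_)
  simp only [s, Finset.mul_sum]
  refine Finset.sum_congr rfl fun i hi => ?_
  have hsq : ((-1 : 𝕜) ^ (multiWord β).length) * (-1) ^ (multiWord β).length = 1 := by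
    rw [← mul_pow]; simp
  rw [← wordDeriv_multiWord_apply i φ x, show (fun j => (List.ofFn i.2).count j) = β from
    (Finset.mem_filter.mp hi).2]
  linear_combination (-(wordDeriv (multiWord β) φ x * t i x)) * hsq

theorem integralBound_of_eq_sum_multiDeriv {T : Distr d 𝕜}
    (hT : ∀ k : ℕ, ∃ (F : Finset (Fin d → ℕ)) (t : (Fin d → ℕ) → Rd d → 𝕜),
      (∀ β ∈ F, MemLp (fun x => Real.exp (k * ‖x‖) • t β x) ⊤ volume) ∧
      T = ∑ β ∈ F, multiDeriv β (ofFun (t β))) : IntegralBound T := by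
  intro k
  obtain ⟨F, t, ht, rfl⟩ := hT k
  choose! C hC0 hC using fun β hβ => norm_le_of_memLp_exp_smul (ht β hβ)
  let M : ℕ := F.sup fun β => (multiWord β).length
  refine ⟨∑ β ∈ F, C β, M, Finset.sum_nonneg hC0, fun φ => ?_⟩
  rw [sum_apply, Finset.sum_mul]
  refine norm_sum_le_of_le _ fun β hβ => ?_
  have hM : (multiWord β).length ≤ M := Finset.le_sup (f := fun β => (multiWord β).length) hβ
  have h1 : ‖multiDeriv β (ofFun (t β)) φ‖
      ≤ C β * ∫ x, Real.exp (-(k * ‖x‖)) * ‖iteratedFDeriv ℝ (multiWord β).length φ x‖ := by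
    rw [multiDeriv_apply, ofFun_apply (memLp_of_memLp_exp_smul (ht β hβ)), norm_mul, norm_pow,
      norm_neg, norm_one, one_pow, one_mul, ← integral_const_mul]
    refine norm_integral_le_of_norm_le
      ((integrable_exp_mul_norm_iteratedFDeriv k φ _).const_mul _) ?_
    filter_upwards [hC β hβ] with x hx
    rw [norm_mul, mul_comm, ← mul_assoc]
    exact mul_le_mul hx (norm_wordDeriv_le _ _ _) (norm_nonneg _)
      (mul_nonneg (hC0 β hβ) (Real.exp_pos _).le)
  refine h1.trans (mul_le_mul_of_nonneg_left ?_ (hC0 β hβ))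
  exact Finset.single_le_sum (f := fun n => ∫ x, Real.exp (-(k * ‖x‖)) * ‖iteratedFDeriv ℝ n φ x‖)
    (fun n _ => integral_nonneg fun x => by positivity)
    (Finset.mem_range.mpr (Nat.lt_succ_of_le hM))

end MultiIndex

/-! ### Functionals on the weighted spaces -/

section Functionals

variable {d : ℕ} {𝕜 : Type*} [RCLike 𝕜] {ι : Type} {w : ι → Rd d → ℝ}

theorem norm_smul_iteratedFDeriv_le_weightedSeminorm (p : ι × ℕ) (f : Weighted 𝕜 w) (x : Rd d) :
    ‖w p.1 x • iteratedFDeriv ℝ p.2 f x‖ ≤ weightedSeminorm w p f :=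
  le_ciSup (f.2.2 p.1 p.2) x

theorem weightedSeminorm_le {p : ι × ℕ} {f : Weighted 𝕜 w} {B : ℝ}
    (h : ∀ x, ‖w p.1 x • iteratedFDeriv ℝ p.2 f x‖ ≤ B) : weightedSeminorm w p f ≤ B :=
  ciSup_le h

/-- The sum of finitely many seminorms is at most their number times their supremum. -/
theorem continuous_of_norm_le_sum_weightedSeminorm (S : Weighted 𝕜 w →ₗ[𝕜] 𝕜)
    (s : Finset (ι × ℕ)) {C : ℝ} (hC : 0 ≤ C)
    (h : ∀ f, ‖S f‖ ≤ C * ∑ p ∈ s, weightedSeminorm w p f) : Continuous S := by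
  refine (weighted_withSeminorms (𝕜 := 𝕜) w).continuous_normedSpace_rng 𝕜 S
    ⟨s, ⟨C * s.card, by positivity⟩, fun f => (h f).trans ?_⟩
  change _ ≤ C * s.card * (s.sup (weightedSeminorm w)) f
  rw [mul_assoc, ← nsmul_eq_mul]
  refine mul_le_mul_of_nonneg_left (Finset.sum_le_card_nsmul _ _ _ fun p hp => ?_) hC
  exact Seminorm.le_finset_sup_apply hp

/-- Bounded densities define a functional on a space of smooth functions, also after multiplication
with a function `h` whose growth is compensated by the decay of the densities. -/
theorem exists_functional_of_densities {i₀ : ι} (hw : ∀ x, 1 ≤ w i₀ x) {M κ : ℕ} {h : Rd d → ℝ}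
    (hh : ContDiff ℝ ∞ h) {A : ℝ}
    (hA : ∀ x, ∀ n ≤ M, ‖iteratedFDeriv ℝ n h x‖ ≤ A * Real.exp (κ * ‖x‖))
    {t : Tuple d M → Rd d → 𝕜} (htm : ∀ i, AEStronglyMeasurable (t i) volume) {C : ℝ}
    (htC : ∀ i, ∀ᵐ x, ‖t i x‖ ≤ C * Real.exp (-((κ + 1 : ℕ) * ‖x‖))) :
    ∃ S : Weighted 𝕜 w →L[𝕜] 𝕜, ∀ f : Weighted 𝕜 w,
      S f = ∑ i, ∫ x, tupleDeriv i (fun x => h x • f x) x * t i x := by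
  have hA0 : 0 ≤ A := by
    have := (norm_nonneg _).trans (hA 0 0 (Nat.zero_le _))
    simpa using this
  let P : Weighted 𝕜 w → ℝ := fun f =>
    ∑ p ∈ (Finset.range (M + 1)).map ⟨fun n => (i₀, n), fun a b hab => (Prod.mk.inj hab).2⟩,
      weightedSeminorm w p f
  have hP : ∀ f x, ∑ n ∈ Finset.range (M + 1), ‖iteratedFDeriv ℝ n f.1 x‖ ≤ P f := by
    intro f x
    simp only [P, Finset.sum_map]
    refine Finset.sum_le_sum fun n _ => ?_
    refine le_trans ?_ (norm_smul_iteratedFDeriv_le_weightedSeminorm (i₀, n) f x)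
    rw [norm_smul, Real.norm_eq_abs, abs_of_nonneg (zero_le_one.trans (hw x))]
    exact le_mul_of_one_le_left (norm_nonneg _) (hw x)
  have hP0 : ∀ f, 0 ≤ P f := fun f => Finset.sum_nonneg fun p _ => apply_nonneg _ f
  have hbound : ∀ (f : Weighted 𝕜 w) (i : Tuple d M), ∀ᵐ x,
      ‖tupleDeriv i (fun x => h x • f x) x * t i x‖ ≤ 2 ^ M * A * P f * C * Real.exp (-‖x‖) := by
    intro f i
    filter_upwards [htC i] with x hx
    have hi : (i.1 : ℕ) ≤ M := Nat.lt_succ_iff.mp i.1.2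
    have h1 : ‖tupleDeriv i (fun x => h x • f x) x‖
        ≤ 2 ^ M * (A * Real.exp (κ * ‖x‖)) * P f := by
      refine (norm_tupleDeriv_le _ _ _).trans ((norm_iteratedFDeriv_smul_le_of_bound hh f.2.1
        fun n hn => hA x n (hn.trans hi)).trans ?_)
      refine mul_le_mul (mul_le_mul_of_nonneg_right (pow_le_pow_right₀ one_le_two hi)
        (by positivity)) (le_trans ?_ (hP f x)) (Finset.sum_nonneg fun _ _ => norm_nonneg _)
        (by positivity)
      exact Finset.sum_le_sum_of_subset_of_nonneg (Finset.range_subset_range.mpr (by omega))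
        fun _ _ _ => norm_nonneg _
    have e : Real.exp (-‖x‖)
        = Real.exp (κ * ‖x‖) * Real.exp (-((κ + 1 : ℕ) * ‖x‖)) := by
      rw [← Real.exp_add]
      congr 1
      push_cast
      ring
    rw [norm_mul, e]
    have hPf := hP0 f
    refine (mul_le_mul h1 hx (norm_nonneg _) (by positivity)).trans (le_of_eq (by ring))
  have hhf : ∀ f : Weighted 𝕜 w, ContDiff ℝ ∞ fun x => h x • f x := fun f => hh.smul f.2.1
  have hint : ∀ (f : Weighted 𝕜 w) (i : Tuple d M),
      Integrable fun x => tupleDeriv i (fun x => h x • f x) x * t i x := fun f i =>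
    (integrable_exp_neg_norm.const_mul _).mono'
      ((continuous_tupleDeriv i (hhf f)).aestronglyMeasurable.mul (htm i)) (hbound f i)
  let S : Weighted 𝕜 w →ₗ[𝕜] 𝕜 :=
    { toFun := fun f => ∑ i, ∫ x, tupleDeriv i (fun x => h x • f x) x * t i x
      map_add' := fun f g => by
        rw [← Finset.sum_add_distrib]
        refine Finset.sum_congr rfl fun i _ => ?_
        rw [← integral_add (hint f i) (hint g i)]
        refine integral_congr_ae (ae_of_all _ fun x => ?_)
        have e : (fun x => h x • (f + g) x) = (fun x => h x • f x) + fun x => h x • g x :=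
          funext fun x => smul_add (h x) (f x) (g x)
        simp only [e]
        rw [tupleDeriv_add i (hhf f) (hhf g), add_mul]
      map_smul' := fun c f => by
        rw [RingHom.id_apply, Finset.smul_sum]
        refine Finset.sum_congr rfl fun i _ => ?_
        rw [← integral_smul]
        refine integral_congr_ae (ae_of_all _ fun x => ?_)
        have e : (fun x => h x • (c • f) x) = c • fun x => h x • f x :=
          funext fun x => smul_comm (h x) c (f x)
        simp only [e]
        rw [tupleDeriv_smul i c (hhf f), smul_mul_assoc] }
  have hSP : ∀ f, ‖S f‖ ≤ (Fintype.card (Tuple d M) *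
      (2 ^ M * A * |C| * ∫ x : Rd d, Real.exp (-‖x‖))) * P f := by
    intro f
    have h1 : ∀ i ∈ Finset.univ, ‖∫ x, tupleDeriv i (fun x => h x • f x) x * t i x‖
        ≤ 2 ^ M * A * |C| * (∫ x : Rd d, Real.exp (-‖x‖)) * P f := by
      intro i _
      refine (norm_integral_le_of_norm_le (integrable_exp_neg_norm.const_mul _)
        (hbound f i)).trans ?_
      rw [integral_const_mul]
      have hI : 0 ≤ ∫ x : Rd d, Real.exp (-‖x‖) := integral_nonneg fun _ => (Real.exp_pos _).le
      have hc : 0 ≤ 2 ^ M * A * P f := mul_nonneg (by positivity) (hP0 f)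
      calc 2 ^ M * A * P f * C * ∫ x : Rd d, Real.exp (-‖x‖)
          ≤ 2 ^ M * A * P f * |C| * ∫ x : Rd d, Real.exp (-‖x‖) :=
            mul_le_mul_of_nonneg_right (mul_le_mul_of_nonneg_left (le_abs_self C) hc) hI
        _ = _ := by ring
    refine (norm_sum_le _ _).trans ((Finset.sum_le_card_nsmul _ _ _ h1).trans (le_of_eq ?_))
    rw [Finset.card_univ, nsmul_eq_mul]
    ring
  have hI : 0 ≤ ∫ x : Rd d, Real.exp (-‖x‖) := integral_nonneg fun _ => (Real.exp_pos _).le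
  exact ⟨⟨S, continuous_of_norm_le_sum_weightedSeminorm S _ (by positivity) hSP⟩, fun f => rfl⟩

theorem Represented.inBDual_omegaMul {T : Distr d 𝕜} (hT : Represented T) (k : ℕ) :
    InBDual (omegaMul k T) := by
  -- The weight `ω(kx)` grows at most like `e^{kd|x|}`; one more unit of decay gives integrability.
  obtain ⟨M, t, C, htm, htC, hrep⟩ := hT (k * d + 1)
  obtain ⟨A, -, hA⟩ := exists_norm_iteratedFDeriv_omega_le d k M
  obtain ⟨S, hS⟩ := exists_functional_of_densities (w := oneWeight d) (i₀ := ()) (fun _ => le_rfl)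
    (omega_smul_contDiff k) hA htm htC
  refine ⟨S, fun φ => ?_⟩
  rw [hS]
  change _ = T (testMul _ _ φ)
  rw [hrep]
  have e : ⇑(testMul (fun x => omega ((k : ℝ) • x)) (omega_smul_contDiff k) φ)
      = fun x => omega ((k : ℝ) • x) • φ x := funext fun x => testMul_apply _ _ φ x
  rw [e]
  rfl

/-- The densities for every rate of decay define a functional on `Y`. -/
theorem Represented.exists_extends {T : Distr d 𝕜} (hT : Represented T) (k : ℕ) :
    ∃ (S : YSpace d 𝕜 →L[𝕜] 𝕜) (M : ℕ) (t : Tuple d M → Rd d → 𝕜) (C : ℝ),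
      (∀ i, AEStronglyMeasurable (t i) volume) ∧
      (∀ i, ∀ᵐ x, ‖t i x‖ ≤ C * Real.exp (-(k * ‖x‖))) ∧
      Extends expWeight_continuous S T ∧
      ∀ f : YSpace d 𝕜, S f = ∑ i, ∫ x, tupleDeriv i f x * t i x := by
  obtain ⟨M, t, C, htm, htC, hrep⟩ := hT (k + 1)
  obtain ⟨S, hS⟩ := exists_functional_of_densities (w := expWeight d) (i₀ := 0) (M := M) (κ := k)
    (fun x => by simp [expWeight]) (h := fun _ => 1) contDiff_const (A := 1)
    (fun x n _ => by
      have h1 : ‖iteratedFDeriv ℝ n (fun _ : Rd d => (1 : ℝ)) x‖ ≤ 1 := by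
        rcases eq_or_ne n 0 with rfl | hn
        · simp
        · rw [iteratedFDeriv_const_of_ne hn]
          simp
      rw [one_mul]
      exact h1.trans (Real.one_le_exp (by positivity))) htm htC
  simp only [one_smul] at hS
  refine ⟨S, M, t, C, htm, fun i => ?_, fun φ => (hS _).trans (hrep φ).symm, hS⟩
  filter_upwards [htC i] with x hx
  refine hx.trans ?_
  have hC : 0 ≤ C := by
    have := (norm_nonneg _).trans hx
    exact nonneg_of_mul_nonneg_left this (Real.exp_pos _)
  refine mul_le_mul_of_nonneg_left ?_ hC
  rw [Real.exp_le_exp, neg_le_neg_iff]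
  push_cast
  nlinarith [norm_nonneg x]

end Functionals

/-! ### The test functions are dense in `Y` -/

section Density

open Filter Topology

variable {d : ℕ} {𝕜 : Type*} [RCLike 𝕜]

variable (d) in
/-- A smooth function with compact support that is `1` on the unit ball. -/
def bump : ContDiffBump (0 : Rd d) := ⟨1, 2, one_pos, one_lt_two⟩

/-- The cutoff `x ↦ χ(x / (m + 1))`. -/
def cutoff (m : ℕ) (x : Rd d) : ℝ := bump d ((m + 1 : ℝ)⁻¹ • x)

theorem cutoff_contDiff (m : ℕ) : ContDiff ℝ ∞ (cutoff (d := d) m) :=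
  (bump d).contDiff.comp (contDiff_id.const_smul ((m + 1 : ℝ)⁻¹))

/-- The test function `χ(x / (m + 1)) f(x)`. -/
def truncate (m : ℕ) {f : Rd d → 𝕜} (hf : ContDiff ℝ ∞ f) : Test d 𝕜 where
  toFun x := cutoff m x • f x
  contDiff' := (cutoff_contDiff m).smul hf
  hasCompactSupport' := by
    have h : HasCompactSupport (cutoff (d := d) m) :=
      (bump d).hasCompactSupport.comp_homeomorph
        (Homeomorph.smulOfNeZero ((m + 1 : ℝ)⁻¹) (by positivity))
    exact h.mono fun x hx h0 => hx (by
      change cutoff m x • f x = 0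
      rw [h0, zero_smul])
  tsupport_subset' := fun _ _ => trivial

theorem exists_norm_iteratedFDeriv_one_sub_cutoff_le (d N : ℕ) : ∃ A : ℝ, 0 ≤ A ∧
    ∀ (m : ℕ) (x : Rd d), ∀ n ≤ N, ‖iteratedFDeriv ℝ n (fun x => 1 - cutoff m x) x‖ ≤ A := by
  have hb : ∀ n : ℕ, ∃ A : ℝ, ∀ x : Rd d, ‖iteratedFDeriv ℝ n (fun x => 1 - bump d x) x‖ ≤ A := by
    intro n
    obtain ⟨B, hB⟩ := ((bump d).contDiff.continuous_iteratedFDeriv (m := n) (n := ∞)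
      (mod_cast le_top)).bounded_above_of_compact_support
      ((bump d).hasCompactSupport.iteratedFDeriv (𝕜 := ℝ) n)
    refine ⟨1 + B, fun x => ?_⟩
    have h1 : ‖iteratedFDeriv ℝ n (fun _ : Rd d => (1 : ℝ)) x‖ ≤ 1 := by
      rcases eq_or_ne n 0 with rfl | hn
      · simp
      · rw [iteratedFDeriv_const_of_ne hn]
        simp
    have h2 := iteratedFDeriv_sub_apply (𝕜 := ℝ) (i := n) (x := x)
      (f := fun _ : Rd d => (1 : ℝ)) (g := bump d) contDiff_const.contDiffAt
      (bump d).contDiff.contDiffAt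
    change ‖iteratedFDeriv ℝ n ((fun _ : Rd d => (1 : ℝ)) - ⇑(bump d)) x‖ ≤ _
    rw [h2]
    exact (norm_sub_le _ _).trans (add_le_add h1 (hB x))
  choose A hA using hb
  have hA0 : ∀ n, 0 ≤ A n := fun n => (norm_nonneg _).trans (hA n 0)
  refine ⟨∑ n ∈ Finset.range (N + 1), A n, Finset.sum_nonneg fun n _ => hA0 n, fun m x n hn => ?_⟩
  let g : Rd d →L[ℝ] Rd d := (m + 1 : ℝ)⁻¹ • ContinuousLinearMap.id ℝ (Rd d)
  have hg : ‖g‖ ≤ 1 := by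
    refine ContinuousLinearMap.opNorm_le_bound _ zero_le_one fun z => ?_
    change ‖(m + 1 : ℝ)⁻¹ • z‖ ≤ _
    rw [norm_smul, Real.norm_eq_abs, abs_of_pos (by positivity)]
    exact mul_le_mul_of_nonneg_right
      (inv_le_one_of_one_le₀ (by linarith [Nat.cast_nonneg (α := ℝ) m])) (norm_nonneg z)
  have hc : ContDiff ℝ ∞ fun x : Rd d => 1 - bump d x := contDiff_const.sub (bump d).contDiff
  have h1 := ContinuousLinearMap.iteratedFDeriv_comp_right g hc x (i := n) (mod_cast le_top)
  change ‖iteratedFDeriv ℝ n ((fun x : Rd d => 1 - bump d x) ∘ g) x‖ ≤ _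
  rw [h1]
  refine (ContinuousMultilinearMap.norm_compContinuousLinearMap_le _ _).trans ?_
  rw [Finset.prod_const]
  refine (mul_le_of_le_one_right (norm_nonneg _) (pow_le_one₀ (norm_nonneg _) hg)).trans
    ((hA n _).trans ?_)
  exact Finset.single_le_sum (f := A) (fun n _ => hA0 n)
    (Finset.mem_range.mpr (Nat.lt_succ_of_le hn))

theorem iteratedFDeriv_one_sub_cutoff_smul_eq_zero {m : ℕ} {x : Rd d} (hx : ‖x‖ < m + 1)
    (f : Rd d → 𝕜) (n : ℕ) : iteratedFDeriv ℝ n (fun x => (1 - cutoff m x) • f x) x = 0 := by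
  have h : (fun x => (1 - cutoff m x) • f x) =ᶠ[𝓝 x] fun _ => 0 := by
    filter_upwards [isOpen_lt continuous_norm continuous_const |>.mem_nhds hx] with y hy
    have h1 : cutoff m y = 1 := by
      refine (bump d).one_of_mem_closedBall (mem_closedBall_zero_iff.mpr ?_)
      rw [norm_smul, Real.norm_eq_abs, abs_of_pos (by positivity)]
      exact inv_mul_le_one_of_le₀ (le_of_lt hy) (by positivity)
    rw [h1, sub_self, zero_smul]
  rw [(h.iteratedFDeriv ℝ n).eq_of_nhds, iteratedFDeriv_fun_zero]
  rfl

/-- The truncation error vanishes on the ball of radius `m + 1`; outside of it the weight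
`e^{k|x|}` is at most `e^{-m}` times the weight `e^{(k+1)|x|}`. -/
theorem tendsto_truncate (f : YSpace d 𝕜) :
    Tendsto (fun m => (ofTest expWeight_continuous (truncate m f.2.1) : YSpace d 𝕜)) atTop
      (𝓝 f) := by
  rw [(weighted_withSeminorms (𝕜 := 𝕜) (expWeight d)).tendsto_nhds]
  rintro ⟨k, n⟩ ε hε
  obtain ⟨A, hA, hA'⟩ := exists_norm_iteratedFDeriv_one_sub_cutoff_le d n
  let P : ℝ := ∑ i ∈ Finset.range (n + 1), weightedSeminorm (expWeight d) (k + 1, i) f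
  have hP : 0 ≤ P := Finset.sum_nonneg fun i _ => apply_nonneg _ f
  have hb : ∀ m : ℕ, weightedSeminorm (expWeight d) (k, n)
      ((ofTest expWeight_continuous (truncate m f.2.1) : YSpace d 𝕜) - f)
      ≤ 2 ^ n * A * P * Real.exp (-(m : ℝ)) := by
    intro m
    refine weightedSeminorm_le fun x => ?_
    have e : ((ofTest expWeight_continuous (truncate m f.2.1) : YSpace d 𝕜) - f).1
        = -fun x => (1 - cutoff m x) • f x := by
      funext x
      change cutoff m x • f x - f x = -((1 - cutoff m x) • f x)
      rw [sub_smul, one_smul, neg_sub]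
    change ‖expWeight d k x • iteratedFDeriv ℝ n (Subtype.val _) x‖ ≤ _
    rw [e, iteratedFDeriv_neg_apply, smul_neg, norm_neg]
    by_cases hx : ‖x‖ < m + 1
    · rw [iteratedFDeriv_one_sub_cutoff_smul_eq_zero hx, smul_zero, norm_zero]
      positivity
    · rw [norm_smul, expWeight, Real.norm_eq_abs, Real.abs_exp]
      have h1 := norm_iteratedFDeriv_smul_le_of_bound (x := x) (n := n)
        (contDiff_const.sub (cutoff_contDiff m)) f.2.1 (hA' m x)
      have h2 : Real.exp (k * ‖x‖) * ∑ i ∈ Finset.range (n + 1), ‖iteratedFDeriv ℝ i f.1 x‖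
          ≤ P * Real.exp (-(m : ℝ)) := by
        rw [Finset.mul_sum, Finset.sum_mul]
        refine Finset.sum_le_sum fun i _ => ?_
        have h3 := norm_smul_iteratedFDeriv_le_weightedSeminorm (k + 1, i) f x
        rw [norm_smul, expWeight, Real.norm_eq_abs, Real.abs_exp] at h3
        rw [Real.exp_neg, ← div_eq_mul_inv, le_div_iff₀ (Real.exp_pos _)]
        refine le_trans ?_ h3
        rw [mul_right_comm, ← Real.exp_add]
        refine mul_le_mul_of_nonneg_right ?_ (norm_nonneg _)
        rw [Real.exp_le_exp]
        push_cast
        linarith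
      calc _ ≤ Real.exp (k * ‖x‖)
            * (2 ^ n * A * ∑ i ∈ Finset.range (n + 1), ‖iteratedFDeriv ℝ i f.1 x‖) :=
            mul_le_mul_of_nonneg_left h1 (Real.exp_pos _).le
        _ = 2 ^ n * A * (Real.exp (k * ‖x‖)
            * ∑ i ∈ Finset.range (n + 1), ‖iteratedFDeriv ℝ i f.1 x‖) := by ring
        _ ≤ 2 ^ n * A * (P * Real.exp (-(m : ℝ))) :=
            mul_le_mul_of_nonneg_left h2 (by positivity)
        _ = _ := by ring
  have hlim : Tendsto (fun m : ℕ => 2 ^ n * A * P * Real.exp (-(m : ℝ))) atTop (𝓝 0) := by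
    have := (Real.tendsto_exp_neg_atTop_nhds_zero.comp
      tendsto_natCast_atTop_atTop).const_mul (2 ^ n * A * P)
    simpa using this
  filter_upwards [hlim.eventually (gt_mem_nhds hε)] with m hm
  exact (hb m).trans_lt hm

/-- A distribution has at most one extension to `Y`, by density. -/
theorem eq_of_extends {S S' : YSpace d 𝕜 →L[𝕜] 𝕜} {T : Distr d 𝕜}
    (hS : Extends expWeight_continuous S T) (hS' : Extends expWeight_continuous S' T) :
    S = S' := by
  ext f
  have h := (S.continuous.tendsto f).comp (tendsto_truncate f)
  have h' := (S'.continuous.tendsto f).comp (tendsto_truncate f)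
  refine tendsto_nhds_unique h (h'.congr fun m => ?_)
  exact (hS' _).trans (hS _).symm

end Density

/-! ### Correlations of decaying functions are smooth and decaying -/

section Correlation

variable {d : ℕ} {𝕜 : Type*} [RCLike 𝕜]

/-- The vector-valued analogue of membership in `Y`. -/
def RapidDecay {G : Type*} [NormedAddCommGroup G] [NormedSpace ℝ G] (ψ : Rd d → G) : Prop :=
  ContDiff ℝ ∞ ψ ∧ ∀ k n : ℕ, ∃ C : ℝ, 0 ≤ C ∧
    ∀ x, ‖iteratedFDeriv ℝ n ψ x‖ ≤ C * Real.exp (-(k * ‖x‖))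

theorem RapidDecay.fderiv {G : Type*} [NormedAddCommGroup G] [NormedSpace ℝ G] {ψ : Rd d → G}
    (hψ : RapidDecay ψ) : RapidDecay (fderiv ℝ ψ) := by
  refine ⟨hψ.1.fderiv_right (by simp), fun k n => ?_⟩
  obtain ⟨C, hC, h⟩ := hψ.2 k (n + 1)
  exact ⟨C, hC, fun x => by rw [norm_iteratedFDeriv_fderiv]; exact h x⟩

theorem RapidDecay.exists_norm_le {G : Type*} [NormedAddCommGroup G] [NormedSpace ℝ G]
    {ψ : Rd d → G} (hψ : RapidDecay ψ) (k : ℕ) :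
    ∃ C : ℝ, 0 ≤ C ∧ ∀ x, ‖ψ x‖ ≤ C * Real.exp (-(k * ‖x‖)) := by
  obtain ⟨C, hC, h⟩ := hψ.2 k 0
  exact ⟨C, hC, fun x => by simpa using h x⟩

theorem exp_neg_mul_norm_le (k : ℕ) (x y : Rd d) :
    Real.exp (-(k * ‖x‖)) ≤ Real.exp (k * ‖x + y‖) * Real.exp (-(k * ‖y‖)) := by
  rw [← Real.exp_add, Real.exp_le_exp]
  have h : ‖y‖ ≤ ‖x + y‖ + ‖x‖ := by
    have := norm_sub_le (x + y) x
    rwa [add_sub_cancel_left] at this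
  have := mul_le_mul_of_nonneg_left h (Nat.cast_nonneg (α := ℝ) k)
  linarith

variable {k : ℕ} {t : Rd d → 𝕜} {C : ℝ} {G : Type*} [NormedAddCommGroup G] [NormedSpace ℝ G]
  [NormedSpace 𝕜 G]

/-- The integrand of a correlation is dominated by an integrable function of `x + y`, times the
decay in `y`. -/
theorem exists_norm_smul_le (htC : ∀ᵐ x, ‖t x‖ ≤ C * Real.exp (-(k * ‖x‖))) {ψ : Rd d → G}
    (hψ : RapidDecay ψ) : ∃ B : ℝ, 0 ≤ B ∧ ∀ᵐ x, ∀ y,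
      ‖t x • ψ (x + y)‖ ≤ B * Real.exp (-(k * ‖y‖)) * Real.exp (-‖x + y‖) := by
  obtain ⟨D, hD, h⟩ := hψ.exists_norm_le (k + 1)
  refine ⟨|C| * D, by positivity, ?_⟩
  filter_upwards [htC] with x hx y
  have h1 : ‖t x‖ ≤ |C| * (Real.exp (k * ‖x + y‖) * Real.exp (-(k * ‖y‖))) :=
    hx.trans (mul_le_mul (le_abs_self C) (exp_neg_mul_norm_le k x y) (Real.exp_pos _).le
      (abs_nonneg C))
  have e : Real.exp (-‖x + y‖)
      = Real.exp (k * ‖x + y‖) * Real.exp (-((k + 1 : ℕ) * ‖x + y‖)) := by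
    rw [← Real.exp_add]
    congr 1
    push_cast
    ring
  rw [norm_smul, e]
  exact (mul_le_mul h1 (h (x + y)) (norm_nonneg _) (by positivity)).trans (le_of_eq (by ring))

theorem hasFDerivAt_correlation [SMulCommClass ℝ 𝕜 G] (htm : AEStronglyMeasurable t volume)
    (htC : ∀ᵐ x, ‖t x‖ ≤ C * Real.exp (-(k * ‖x‖))) {ψ : Rd d → G} (hψ : RapidDecay ψ)
    (y₀ : Rd d) :
    HasFDerivAt (fun y => ∫ x, t x • ψ (x + y)) (∫ x, t x • fderiv ℝ ψ (x + y₀)) y₀ := by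
  have hm : ∀ {G : Type _} [NormedAddCommGroup G] [NormedSpace ℝ G] [NormedSpace 𝕜 G]
      {ψ : Rd d → G}, RapidDecay ψ → ∀ y : Rd d,
      AEStronglyMeasurable (fun x => t x • ψ (x + y)) volume := fun hψ y =>
    htm.smul (hψ.1.continuous.comp (continuous_add_const y)).aestronglyMeasurable
  have hi : ∀ y : Rd d, Integrable fun x => Real.exp (-‖x + y‖) := fun y =>
    integrable_exp_neg_norm.comp_add_right y
  obtain ⟨B, hB, hb⟩ := exists_norm_smul_le htC hψ
  obtain ⟨B', hB', hb'⟩ := exists_norm_smul_le htC hψ.fderiv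
  refine hasFDerivAt_integral_of_dominated_of_fderiv_le (𝕜 := ℝ) (s := Metric.ball y₀ 1)
    (bound := fun x => B' * (Real.exp 1 * Real.exp (-‖x + y₀‖)))
    (F' := fun y x => t x • fderiv ℝ ψ (x + y)) (Metric.ball_mem_nhds y₀ one_pos)
    (Filter.Eventually.of_forall (hm hψ)) ?_ (hm hψ.fderiv y₀) ?_
    (((hi y₀).const_mul _).const_mul _) (ae_of_all _ fun x y _ => ?_)
  · exact ((hi y₀).const_mul (B * Real.exp (-(k * ‖y₀‖)))).mono' (hm hψ y₀)
      (hb.mono fun x hx => hx y₀)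
  · filter_upwards [hb'] with x hx y hy
    refine (hx y).trans ?_
    rw [mul_assoc]
    refine mul_le_mul_of_nonneg_left ?_ hB'
    rw [← Real.exp_add, ← Real.exp_add, Real.exp_le_exp]
    have h1 : ‖x + y₀‖ ≤ ‖x + y‖ + ‖y - y₀‖ := by
      have := norm_sub_le (x + y) (y - y₀)
      rwa [show x + y - (y - y₀) = x + y₀ by abel] at this
    have h2 : ‖y - y₀‖ < 1 := mem_ball_iff_norm.mp hy
    have h3 : 0 ≤ (k : ℝ) * ‖y‖ := by positivity
    linarith
  · have h1 : HasFDerivAt (fun y => ψ (x + y)) (fderiv ℝ ψ (x + y)) y := by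
      have := ((hψ.1.differentiable (by simp)) (x + y)).hasFDerivAt.comp y
        ((hasFDerivAt_id y).const_add x)
      exact this
    exact h1.const_smul (t x)

/-- The correlation of a density of size `O(e^{-k|x|})` with a rapidly decaying function is smooth,
and its derivatives are correlations of the same kind, so that they decay at the rate of the
density. -/
theorem correlation_contDiff_and_decay [SMulCommClass ℝ 𝕜 G]
    (htm : AEStronglyMeasurable t volume)
    (htC : ∀ᵐ x, ‖t x‖ ≤ C * Real.exp (-(k * ‖x‖))) {ψ : Rd d → G} (hψ : RapidDecay ψ) (n : ℕ) :
    ContDiff ℝ n (fun y => ∫ x, t x • ψ (x + y)) ∧ ∃ B : ℝ, ∀ y,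
      ‖iteratedFDeriv ℝ n (fun y => ∫ x, t x • ψ (x + y)) y‖ ≤ B * Real.exp (-(k * ‖y‖)) := by
  induction n generalizing G with
  | zero =>
    have hd := hasFDerivAt_correlation htm htC hψ
    refine ⟨contDiff_zero.mpr
      (continuous_iff_continuousAt.mpr fun y => (hd y).continuousAt), ?_⟩
    obtain ⟨B, hB, hb⟩ := exists_norm_smul_le htC hψ
    refine ⟨B * ∫ x : Rd d, Real.exp (-‖x‖), fun y => ?_⟩
    rw [norm_iteratedFDeriv_zero]
    refine (norm_integral_le_of_norm_le ((integrable_exp_neg_norm.comp_add_right y).const_mul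
      (B * Real.exp (-(k * ‖y‖)))) (hb.mono fun x hx => hx y)).trans (le_of_eq ?_)
    rw [integral_const_mul, integral_add_right_eq_self fun x : Rd d => Real.exp (-‖x‖)]
    ring
  | succ n ih =>
    have hd := hasFDerivAt_correlation htm htC hψ
    have e : fderiv ℝ (fun y => ∫ x, t x • ψ (x + y)) = fun y => ∫ x, t x • fderiv ℝ ψ (x + y) :=
      funext fun y => (hd y).fderiv
    obtain ⟨h1, B, hB⟩ := ih hψ.fderiv
    refine ⟨?_, B, fun y => ?_⟩
    · rw [Nat.cast_succ, contDiff_succ_iff_fderiv]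
      refine ⟨fun y => (hd y).differentiableAt, fun h => by simp at h, ?_⟩
      rw [e]
      exact h1
    · rw [← norm_iteratedFDeriv_fderiv, e]
      exact hB y

theorem norm_iteratedFDeriv_iteratedFDeriv {E G : Type*} [NormedAddCommGroup E] [NormedSpace ℝ E]
    [NormedAddCommGroup G] [NormedSpace ℝ G] (f : E → G) (m n : ℕ) (x : E) :
    ‖iteratedFDeriv ℝ m (iteratedFDeriv ℝ n f) x‖ = ‖iteratedFDeriv ℝ (m + n) f x‖ := by
  induction m generalizing n with
  | zero => rw [norm_iteratedFDeriv_zero, Nat.zero_add]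
  | succ m ih =>
    rw [← norm_iteratedFDeriv_fderiv, fderiv_iteratedFDeriv,
      LinearIsometryEquiv.norm_iteratedFDeriv_comp_left, ih, Nat.add_right_comm, Nat.add_assoc]

theorem rapidDecay_tupleDeriv {M : ℕ} (i : Tuple d M) (φ : YSpace d 𝕜) :
    RapidDecay (tupleDeriv i φ) := by
  let L := ContinuousMultilinearMap.apply ℝ (fun _ : Fin i.1 => Rd d) 𝕜
    fun l => EuclideanSpace.single (i.2 l) (1 : ℝ)
  have hc : ContDiff ℝ ∞ (iteratedFDeriv ℝ i.1 φ) := φ.2.1.iteratedFDeriv_right (mod_cast le_top)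
  have e : tupleDeriv i φ = L ∘ iteratedFDeriv ℝ i.1 φ := rfl
  refine ⟨e ▸ L.contDiff.comp hc, fun k n => ?_⟩
  refine ⟨‖L‖ * weightedSeminorm (expWeight d) (k, n + i.1) φ,
    mul_nonneg (norm_nonneg L) (apply_nonneg _ φ), fun x => ?_⟩
  rw [e]
  refine (L.norm_iteratedFDeriv_comp_left hc.contDiffAt (n := n) (mod_cast le_top)).trans ?_
  rw [mul_assoc]
  refine mul_le_mul_of_nonneg_left ?_ (norm_nonneg _)
  rw [norm_iteratedFDeriv_iteratedFDeriv, Real.exp_neg, ← div_eq_mul_inv,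
    le_div_iff₀ (Real.exp_pos _), mul_comm]
  have h := norm_smul_iteratedFDeriv_le_weightedSeminorm (k, n + (i.1 : ℕ)) φ x
  rwa [norm_smul, expWeight, Real.norm_eq_abs, Real.abs_exp] at h

/-- Translates of functions in `Y` against `T` are sums of correlations. The densities depend on the
rate `k`, but the functional on `Y` does not, so all rates of decay hold for the same function. -/
theorem Represented.exists_extends_translate_mem {T : Distr d 𝕜} (hT : Represented T) :
    ∃ S : YSpace d 𝕜 →L[𝕜] 𝕜, Extends expWeight_continuous S T ∧
      ∀ φ : YSpace d 𝕜, (fun y => S (yTranslate y φ)) ∈ weighted 𝕜 (expWeight d) := by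
  choose S M t C htm htC hext hrep using hT.exists_extends
  refine ⟨S 0, hext 0, fun φ => ?_⟩
  have hF : ∀ k : ℕ, (fun y => S 0 (yTranslate y φ))
      = fun y => ∑ i, ∫ x, t k i x • tupleDeriv i φ (x + y) := by
    intro k
    funext y
    rw [eq_of_extends (hext 0) (hext k), hrep k]
    refine Finset.sum_congr rfl fun i _ => integral_congr_ae (ae_of_all _ fun x => ?_)
    have h1 : tupleDeriv i (yTranslate y φ) x = tupleDeriv i φ (x + y) := by
      unfold tupleDeriv
      rw [show iteratedFDeriv ℝ i.1 (yTranslate y φ) x = iteratedFDeriv ℝ i.1 φ (x + y) from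
        iteratedFDeriv_comp_add_right i.1 y x]
    change tupleDeriv i (yTranslate y φ) x * t k i x = t k i x • tupleDeriv i φ (x + y)
    rw [h1, smul_eq_mul, mul_comm]
  have hcorr := fun k n i => correlation_contDiff_and_decay (htm k i) (htC k i)
    (rapidDecay_tupleDeriv i φ) n
  refine ⟨contDiff_infty.mpr fun n => ?_, fun k n => ?_⟩
  · rw [hF 0]
    exact ContDiff.sum fun i _ => (hcorr 0 n i).1
  · choose B hB using fun i => (hcorr k n i).2
    refine ⟨∑ i, B i, ?_⟩
    rintro _ ⟨y, rfl⟩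
    simp only [norm_smul, expWeight, Real.norm_eq_abs, Real.abs_exp]
    rw [hF k, iteratedFDeriv_sum fun i _ => (hcorr k n i).1, Finset.sum_apply, mul_comm,
      ← le_div_iff₀ (Real.exp_pos _), div_eq_mul_inv, ← Real.exp_neg, Finset.sum_mul]
    exact norm_sum_le_of_le _ fun i _ => hB i y

end Correlation

/-! ### From functionals on the weighted spaces back to translates -/

section Translates

variable {d : ℕ} {𝕜 : Type*} [RCLike 𝕜]

theorem expDecreasing_of_extends {T : Distr d 𝕜} {S : YSpace d 𝕜 →L[𝕜] 𝕜}
    (hS : Extends expWeight_continuous S T)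
    (hmem : ∀ φ : YSpace d 𝕜, (fun y => S (yTranslate y φ)) ∈ weighted 𝕜 (expWeight d))
    (φ : Test d 𝕜) : ExpDecreasing fun y => T (testTranslate y φ) := by
  have e : (fun y => T (testTranslate y φ))
      = fun y => S (yTranslate y (ofTest expWeight_continuous φ)) :=
    funext fun y => (hS (testTranslate y φ)).symm
  rw [e]
  have h := hmem (ofTest expWeight_continuous φ)
  refine ⟨h.1.continuous, fun k => ?_⟩
  obtain ⟨C, hC⟩ := h.2 k 0
  refine ⟨C, fun y => ?_⟩
  have := hC ⟨y, rfl⟩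
  simp only [norm_smul, expWeight, Real.norm_eq_abs, Real.abs_exp, norm_iteratedFDeriv_zero] at this
  rwa [mul_comm]

/-- A functional that extends to the bounded smooth functions has finite order, globally. -/
theorem InBDual.exists_bound {U : Distr d 𝕜} (hU : InBDual U) : ∃ (C : ℝ) (N : ℕ), 0 ≤ C ∧
    ∀ (φ : Test d 𝕜) (B : ℝ), 0 ≤ B → (∀ n ≤ N, ∀ x, ‖iteratedFDeriv ℝ n φ x‖ ≤ B) →
      ‖U φ‖ ≤ C * B := by
  obtain ⟨S, hS⟩ := hU
  obtain ⟨s, C, -, hC⟩ := Seminorm.bound_of_continuous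
    (weighted_withSeminorms (𝕜 := 𝕜) (oneWeight d)) ((normSeminorm 𝕜 𝕜).comp S.toLinearMap)
    S.continuous.norm
  refine ⟨C, s.sup Prod.snd, C.2, fun φ B hB h => ?_⟩
  rw [← hS φ]
  refine (hC (ofTest oneWeight_continuous φ)).trans (mul_le_mul_of_nonneg_left ?_ C.2)
  refine Seminorm.finset_sup_apply_le hB fun p hp => weightedSeminorm_le fun x => ?_
  change ‖(1 : ℝ) • iteratedFDeriv ℝ p.2 φ x‖ ≤ B
  rw [one_smul]
  exact h _ (Finset.le_sup (f := Prod.snd) hp) x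

theorem InBDual.conv_continuous_bounded {U : Distr d 𝕜} (hU : InBDual U) (φ : Test d 𝕜) :
    Continuous (conv U φ) ∧ ∃ C : ℝ, ∀ y, ‖conv U φ y‖ ≤ C := by
  obtain ⟨C, N, hC, h⟩ := hU.exists_bound
  have hb : ∀ n : ℕ, ∃ A : ℝ, ∀ x, ‖iteratedFDeriv ℝ n φ x‖ ≤ A := fun n =>
    (φ.contDiff.continuous_iteratedFDeriv (mod_cast le_top)).bounded_above_of_compact_support
      (φ.hasCompactSupport.iteratedFDeriv (𝕜 := ℝ) n)
  choose A hA using hb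
  have hA0 : ∀ n, 0 ≤ A n := fun n => (norm_nonneg _).trans (hA n 0)
  let B : ℝ := ∑ n ∈ Finset.range (N + 2), A n
  have hB0 : 0 ≤ B := Finset.sum_nonneg fun n _ => hA0 n
  have hB : ∀ n ≤ N + 1, ∀ x, ‖iteratedFDeriv ℝ n φ x‖ ≤ B := fun n hn x =>
    (hA n x).trans (Finset.single_le_sum (f := A) (fun n _ => hA0 n)
      (Finset.mem_range.mpr (by omega)))
  refine ⟨?_, C * B, fun y => h _ B hB0 fun n hn x => ?_⟩
  · -- The map `y ↦ φ(y - ·)` is Lipschitz for the norms of the derivatives.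
    refine (LipschitzWith.of_dist_le_mul (K := ⟨C * B, by positivity⟩) fun y y' => ?_).continuous
    rw [dist_eq_norm, dist_eq_norm]
    change ‖U (testReflect y φ) - U (testReflect y' φ)‖ ≤ C * B * ‖y - y'‖
    rw [← map_sub, mul_assoc]
    refine h _ _ (by positivity) fun n hn x => ?_
    let ρ : Rd d → 𝕜 := ⇑φ - fun z => φ (z + (y' - y))
    have e : ⇑(testReflect y φ - testReflect y' φ) = fun z => ρ (y - z) := by
      funext z
      change φ (y - z) - φ (y' - z) = φ (y - z) - φ (y - z + (y' - y))
      congr 2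
      abel
    have hcd : ContDiff ℝ n φ := φ.contDiff.of_le (mod_cast le_top)
    have hρ : iteratedFDeriv ℝ n ρ (y - x) = iteratedFDeriv ℝ n φ (y - x) -
        iteratedFDeriv ℝ n (fun z => φ (z + (y' - y))) (y - x) :=
      iteratedFDeriv_sub_apply (f := ⇑φ) (g := fun z => φ (z + (y' - y))) hcd.contDiffAt
        (hcd.comp (contDiff_id.add contDiff_const)).contDiffAt
    rw [e, norm_iteratedFDeriv_comp_const_sub, hρ, iteratedFDeriv_comp_add_right]
    have hmv := Convex.norm_image_sub_le_of_norm_fderiv_le (𝕜 := ℝ) (s := Set.univ)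
      (f := iteratedFDeriv ℝ n φ) (C := B) (x := y - x + (y' - y)) (y := y - x)
      (fun z _ => φ.contDiff.differentiable_iteratedFDeriv (mod_cast WithTop.coe_lt_top _) z)
      (fun z _ => by
        rw [norm_fderiv_iteratedFDeriv]
        exact hB (n + 1) (by omega) z) convex_univ (Set.mem_univ _) (Set.mem_univ _)
    refine hmv.trans (le_of_eq ?_)
    congr 2
    abel
  · change ‖iteratedFDeriv ℝ n (fun z => φ (y - z)) x‖ ≤ B
    rw [norm_iteratedFDeriv_comp_const_sub]
    exact hB n (by omega) _

end Translates

end ExpDecay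

end

theorem theorem1p2 (d : ℕ) (𝕜 : Type*) [RCLike 𝕜] (T : Distr d 𝕜) :
    List.TFAE [
      ∀ k : ℕ, InBDual (omegaMul k T),
      ∀ k : ℕ, ∃ (F : Finset (Fin d → ℕ)) (t : (Fin d → ℕ) → Rd d → 𝕜),
        (∀ β ∈ F, MemLp (fun x => Real.exp (k * ‖x‖) • t β x) ⊤ volume) ∧
        T = ∑ β ∈ F, multiDeriv β (ofFun (t β)),
      ∃ S : YSpace d 𝕜 →L[𝕜] 𝕜, Extends expWeight_continuous S T ∧
        ∀ φ : YSpace d 𝕜, (fun y => S (yTranslate y φ)) ∈ weighted 𝕜 (expWeight d),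
      ∀ φ : Test d 𝕜, ExpDecreasing fun y => T (testTranslate y φ),
      ∀ (k : ℕ) (φ : Test d 𝕜), Continuous (conv (omegaMul k T) φ) ∧
        ∃ C : ℝ, ∀ y, ‖conv (omegaMul k T) φ y‖ ≤ C] := by
  tfae_have 1 → 5 := fun h k φ => (h k).conv_continuous_bounded φ
  tfae_have 5 → 2 := fun h => (localDecay_of_conv_omegaMul fun k φ =>
    (h k φ).2).integralBound.represented.eq_sum_multiDeriv
  tfae_have 2 → 3 := fun h =>
    (integralBound_of_eq_sum_multiDeriv h).represented.exists_extends_translate_mem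
  tfae_have 3 → 4 := fun ⟨_, hS, hmem⟩ => expDecreasing_of_extends hS hmem
  tfae_have 4 → 1 := fun h => (localDecay_of_translates fun φ =>
    (h φ).2).integralBound.represented.inBDual_omegaMul
  tfae_finish
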